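/- **Theorem 1.7.** Let $\omega$ be a free ultrafilter on $\mathbb N$, let $M_n$ ($n\in\mathbb N$) be finite factors, with their trace states $\tau_n$, such that $\dim M_n\to\infty$, and let $\mathbf M=\Pi_\omega M_n$ be their ultraproduct, that is, the quotient of the algebra of all norm-bounded sequences $(x_n)_n$, $x_n\in M_n$, by the ideal of those with $\lim_{n\to\omega}\tau_n(x_n^*x_n)=0$, with the trace $\tau((x_n)_n)=\lim_{n\to\omega}\tau_n(x_n)$. Call a subset of $\mathbf M$ separable if it is separable in the norm $\|x\|_2=\tau(x^*x)^{1/2}$. Let $P\subset\mathbf M$ be a separable von Neumann subalgebra (containing the unit of $\mathbf M$). Then $$P'\cap\mathbf M=B_0\oplus B_1,$$ where $B_0$ is atomic (its unit is a sum of mutually orthogonal minimal projections of $B_0$) and $B_1$ is diffuse (it has no nonzero minimal projection) and has no nonzero separable direct summand. Even more, for every maximal abelian $^*$-subalgebra $A$ of $B_1$ (that is, $A$ abelian with $A'\cap B_1=A$), every nonzero direct summand of $A$ is non-separable. Here $B_0$ or $B_1$ may be $0$. -/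

import Mathlib

open Filter Topology
open scoped ENNReal ComplexOrder

noncomputable section

/-! ### Finite factors and their traces -/

/-- A (nonzero) von Neumann algebra is a finite factor if its center consists of the scalars and
every isometry in it is a unitary. -/
structure IsFiniteFactor (A : Type*) [CStarAlgebra A] [WStarAlgebra A] [Nontrivial A] : Prop where
  center_eq : ∀ x : A, (∀ y : A, x * y = y * x) → ∃ c : ℂ, x = algebraMap ℂ A c
  finite : ∀ v : A, star v * v = 1 → v * star v = 1

/-- A tracial state. On a finite factor there is exactly one, and it is automatically faithful and
normal. -/
structure TracialState (A : Type*) [CStarAlgebra A] extends A →ₗ[ℂ] ℂ where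
  map_one' : toFun 1 = 1
  nonneg' : ∀ x : A, 0 ≤ toFun (star x * x)
  tracial' : ∀ x y : A, toFun (x * y) = toFun (y * x)

namespace TracialState

variable {A : Type*} [CStarAlgebra A]

instance : CoeFun (TracialState A) (fun _ => A → ℂ) := ⟨fun τ => τ.toLinearMap⟩

theorem norm_apply_le (τ : TracialState A) (x : A) : ‖τ x‖ ≤ ‖x‖ := by
  let _ : PartialOrder A := CStarAlgebra.spectralOrder A
  let _ : StarOrderedRing A := CStarAlgebra.spectralOrderedRing A
  let f : A →ₚ[ℂ] ℂ := PositiveLinearMap.mk₀ τ.toLinearMap fun y hy => by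
    obtain ⟨z, rfl⟩ := CStarAlgebra.nonneg_iff_eq_star_mul_self.mp hy
    exact τ.nonneg' z
  have h1 : ‖f.toPreGNS 1‖ ^ 2 = 1 := by
    have h := f.preGNS_norm_sq (f.toPreGNS 1)
    have h' : f (star (1 : A) * 1) = 1 := by
      rw [star_one, one_mul]; exact τ.map_one'
    simp only [PositiveLinearMap.ofPreGNS_toPreGNS, h'] at h
    exact_mod_cast h
  have h1' : ‖f.toPreGNS 1‖ = 1 := by
    nlinarith [norm_nonneg (f.toPreGNS 1)]
  have h2 : τ x = inner ℂ (f.toPreGNS 1) (f.leftMulMapPreGNS x (f.toPreGNS 1)) := by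
    rw [PositiveLinearMap.preGNS_inner_def]
    simp
    rfl
  rw [h2]
  refine (norm_inner_le_norm _ _).trans ?_
  rw [h1', one_mul]
  refine (ContinuousLinearMap.le_opNorm _ _).trans ?_
  rw [h1', mul_one]
  exact LinearMap.mkContinuous_norm_le _ (norm_nonneg x) _

end TracialState

/-! ### Bounded sequences and the limit trace -/

section Ultraproduct

variable (M : ℕ → Type*) [∀ n, CStarAlgebra (M n)]

/-- The C⋆-algebra `⊕ₙ Mₙ` of norm-bounded sequences `(xₙ)`, `xₙ ∈ Mₙ`, with the supremum norm and
the termwise operations. -/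
def BddSeq : Type _ := lp M ∞

variable [∀ n, Nontrivial (M n)]

instance : NormedRing (BddSeq M) := inferInstanceAs (NormedRing (lp M ∞))
instance : StarRing (BddSeq M) := inferInstanceAs (StarRing (lp M ∞))
instance : CompleteSpace (BddSeq M) := inferInstanceAs (CompleteSpace (lp M ∞))
instance : CStarRing (BddSeq M) := inferInstanceAs (CStarRing (lp M ∞))
instance : NormedAlgebra ℂ (BddSeq M) := inferInstanceAs (NormedAlgebra ℂ (lp M ∞))
instance : StarModule ℂ (BddSeq M) := inferInstanceAs (StarModule ℂ (lp M ∞))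
instance : CStarAlgebra (BddSeq M) where
instance : PartialOrder (BddSeq M) := CStarAlgebra.spectralOrder _
instance : StarOrderedRing (BddSeq M) := CStarAlgebra.spectralOrderedRing _

/-- The `n`-th term of a bounded sequence is written `x n`. -/
instance : CoeFun (BddSeq M) (fun _ => ∀ n, M n) := ⟨fun x => Subtype.val (p := (· ∈ lp M ∞)) x⟩

variable {M}

namespace BddSeq

theorem norm_apply_le (x : BddSeq M) (n : ℕ) : ‖x n‖ ≤ ‖x‖ :=
  lp.norm_apply_le_norm (E := M) ENNReal.top_ne_zero x n

theorem add_apply (x y : BddSeq M) (n : ℕ) : (x + y) n = x n + y n := rfl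
theorem smul_apply (c : ℂ) (x : BddSeq M) (n : ℕ) : (c • x) n = c • x n := rfl
theorem mul_apply (x y : BddSeq M) (n : ℕ) : (x * y) n = x n * y n := rfl
theorem star_apply (x : BddSeq M) (n : ℕ) : (star x) n = star (x n) := rfl
theorem one_apply (n : ℕ) : (1 : BddSeq M) n = 1 := rfl

end BddSeq

variable (τ : ∀ n, TracialState (M n)) (ω : Ultrafilter ℕ)

theorem tendsto_limTrace (x : BddSeq M) :
    Tendsto (fun n => τ n (x n)) ω (𝓝 (limUnder (ω : Filter ℕ) fun n => τ n (x n))) := by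
  have hc : IsCompact (Metric.closedBall (0 : ℂ) ‖x‖) := isCompact_closedBall _ _
  have hmem : ∀ n, τ n (x n) ∈ Metric.closedBall (0 : ℂ) ‖x‖ := fun n => by
    rw [mem_closedBall_zero_iff]
    exact ((τ n).norm_apply_le (x n)).trans (x.norm_apply_le n)
  obtain ⟨c, -, hc⟩ := hc.ultrafilter_le_nhds (ω.map fun n => τ n (x n)) (by
    rw [Ultrafilter.coe_map, Filter.le_principal_iff]
    exact Filter.mem_map.mpr (Filter.univ_mem' hmem))
  exact tendsto_nhds_limUnder ⟨c, hc⟩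

/-- The positive functional `x ↦ lim_{n → ω} τₙ(xₙ)` on bounded sequences. -/
def limTrace : BddSeq M →ₚ[ℂ] ℂ :=
  PositiveLinearMap.mk₀
    { toFun := fun x => limUnder (ω : Filter ℕ) fun n => τ n (x n)
      map_add' := fun x y => by
        refine tendsto_nhds_unique (tendsto_limTrace τ ω (x + y)) ?_
        simpa [BddSeq.add_apply] using (tendsto_limTrace τ ω x).add (tendsto_limTrace τ ω y)
      map_smul' := fun c x => by
        refine tendsto_nhds_unique (tendsto_limTrace τ ω (c • x)) ?_
        simpa [BddSeq.smul_apply] using (tendsto_limTrace τ ω x).const_mul c }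
    fun x hx => by
      obtain ⟨y, rfl⟩ := CStarAlgebra.nonneg_iff_eq_star_mul_self.mp hx
      exact ge_of_tendsto' (tendsto_limTrace τ ω (star y * y)) fun n => (τ n).nonneg' (y n)

theorem tendsto_limTrace' (x : BddSeq M) :
    Tendsto (fun n => τ n (x n)) ω (𝓝 (limTrace τ ω x)) := tendsto_limTrace τ ω x

/-- The Hilbert space `L²(𝐌)` of the ultraproduct `𝐌 = Π_ω Mₙ`: the Hausdorff completion of the
bounded sequences for the inner product `⟨x, y⟩ = lim_{n → ω} τₙ(xₙ⋆ yₙ)`. -/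
abbrev UltraL2 : Type _ := (limTrace τ ω).GNS

/-- The trace vector `1̂ ∈ L²(𝐌)`. The trace of `x ∈ 𝐌` is `⟨1̂, x 1̂⟩`, and `‖x‖₂ = ‖x 1̂‖`. -/
def traceVec : UltraL2 τ ω := ((limTrace τ ω).toPreGNS 1 : (limTrace τ ω).PreGNS)

/-- The class in `𝐌 = Π_ω Mₙ`, acting on `L²(𝐌)` by left multiplication, of a bounded sequence. -/
def ultraClass : BddSeq M →⋆ₐ[ℂ] (UltraL2 τ ω →L[ℂ] UltraL2 τ ω) := (limTrace τ ω).gnsStarAlgHom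

/-- The ultraproduct `𝐌 = Π_ω Mₙ`, in its standard representation on `L²(𝐌)`: the image of the
bounded sequences. By `ultraClass_eq_zero_iff` it is the quotient of `⊕ₙ Mₙ` by the ideal of the
sequences with `lim_{n → ω} τₙ(xₙ⋆ xₙ) = 0`. -/
def ultraproduct : StarSubalgebra ℂ (UltraL2 τ ω →L[ℂ] UltraL2 τ ω) := (ultraClass τ ω).range

theorem ultraClass_coe (x y : BddSeq M) :
    ultraClass τ ω x (((limTrace τ ω).toPreGNS y : (limTrace τ ω).PreGNS) : UltraL2 τ ω) =
      ((limTrace τ ω).toPreGNS (x * y) : (limTrace τ ω).PreGNS) := by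
  simp [ultraClass]

theorem inner_traceVec (x : BddSeq M) :
    inner ℂ (traceVec τ ω) (ultraClass τ ω x (traceVec τ ω)) = limTrace τ ω x := by
  rw [traceVec, ultraClass_coe, UniformSpace.Completion.inner_coe,
    PositiveLinearMap.preGNS_inner_def]
  simp

theorem norm_coe_sq (y : BddSeq M) :
    ((‖(((limTrace τ ω).toPreGNS y : (limTrace τ ω).PreGNS) : UltraL2 τ ω)‖ ^ 2 : ℝ) : ℂ) =
      limTrace τ ω (star y * y) := by
  rw [UniformSpace.Completion.norm_coe, Complex.ofReal_pow, PositiveLinearMap.preGNS_norm_sq]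
  simp

theorem norm_traceVec_sq (x : BddSeq M) :
    ((‖ultraClass τ ω x (traceVec τ ω)‖ ^ 2 : ℝ) : ℂ) = limTrace τ ω (star x * x) := by
  rw [traceVec, ultraClass_coe, mul_one, norm_coe_sq]

theorem limTrace_mul_comm (x y : BddSeq M) : limTrace τ ω (x * y) = limTrace τ ω (y * x) := by
  refine tendsto_nhds_unique (tendsto_limTrace' τ ω (x * y)) ?_
  refine (tendsto_limTrace' τ ω (y * x)).congr fun n => ?_
  exact ((τ n).tracial' (x n) (y n)).symm

theorem ultraClass_eq_zero_iff (x : BddSeq M) :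
    ultraClass τ ω x = 0 ↔ Tendsto (fun n => τ n (star (x n) * x n)) ω (𝓝 0) := by
  have key : Tendsto (fun n => τ n (star (x n) * x n)) ω (𝓝 (limTrace τ ω (star x * x))) :=
    tendsto_limTrace' τ ω (star x * x)
  have hiff : Tendsto (fun n => τ n (star (x n) * x n)) ω (𝓝 0) ↔
      limTrace τ ω (star x * x) = 0 :=
    ⟨fun h => tendsto_nhds_unique key h, fun h => h ▸ key⟩
  rw [hiff]
  constructor
  · intro h
    rw [← norm_traceVec_sq, h]
    simp
  · intro h
    have hx : ultraClass τ ω (star x) (traceVec τ ω) = 0 := by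
      have h' := norm_traceVec_sq τ ω (star x)
      rw [star_star, limTrace_mul_comm, h] at h'
      simpa using h'
    have hbound : ∀ y : BddSeq M, ultraClass τ ω x
        (((limTrace τ ω).toPreGNS y : (limTrace τ ω).PreGNS) : UltraL2 τ ω) = 0 := by
      intro y
      have e1 : ultraClass τ ω (star y * star x) (traceVec τ ω) = 0 := by
        rw [map_mul]
        exact (congrArg (ultraClass τ ω (star y)) hx).trans (map_zero _)
      have e2 := norm_traceVec_sq τ ω (star y * star x)
      rw [e1, ← star_mul, star_star, limTrace_mul_comm] at e2
      have e3 := norm_coe_sq τ ω (x * y)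
      rw [← e2] at e3
      rw [ultraClass_coe]
      have e4 := pow_eq_zero_iff two_ne_zero |>.mp (Complex.ofReal_eq_zero.mp (e3.trans (by simp)))
      exact norm_eq_zero.mp e4
    ext v
    induction v using UniformSpace.Completion.induction_on with
    | hp => exact isClosed_eq (by fun_prop) (by fun_prop)
    | ih v => exact hbound ((limTrace τ ω).ofPreGNS v)

end Ultraproduct

/-! ### Projections, direct summands and maximal abelian subalgebras

The von Neumann algebras `B` below act on a Hilbert space `H`; their units need not be the identity
of `H`, as for direct summands. -/

section Algebras

variable {H : Type*} [NormedAddCommGroup H] [InnerProductSpace ℂ H] [CompleteSpace H]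

/-- `p` is a projection in the center of `B`. -/
structure IsCentralProjection (B : NonUnitalStarSubalgebra ℂ (H →L[ℂ] H)) (p : H →L[ℂ] H) :
    Prop where
  mem : p ∈ B
  proj : IsStarProjection p
  comm : ∀ x ∈ B, x * p = p * x

/-- The direct summand `B p` of `B`, for a central projection `p` of `B`. -/
def directSummand (B : NonUnitalStarSubalgebra ℂ (H →L[ℂ] H)) {p : H →L[ℂ] H}
    (hp : IsCentralProjection B p) : NonUnitalStarSubalgebra ℂ (H →L[ℂ] H) where
  carrier := {x | x ∈ B ∧ x * p = x}
  zero_mem' := ⟨zero_mem B, zero_mul p⟩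
  add_mem' := fun ⟨hx, hx'⟩ ⟨hy, hy'⟩ => ⟨add_mem hx hy, by rw [add_mul, hx', hy']⟩
  mul_mem' := fun ⟨hx, _⟩ ⟨hy, hy'⟩ => ⟨mul_mem hx hy, by rw [mul_assoc, hy']⟩
  smul_mem' := fun c _ ⟨hx, hx'⟩ => ⟨SMulMemClass.smul_mem c hx, by rw [smul_mul_assoc, hx']⟩
  star_mem' := fun {x} ⟨hx, hx'⟩ => ⟨star_mem hx, by
    rw [hp.comm _ (star_mem hx)]
    nth_rewrite 1 [← hp.proj.isSelfAdjoint.star_eq]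
    rw [← star_mul, hx']⟩

theorem mem_directSummand_iff {B : NonUnitalStarSubalgebra ℂ (H →L[ℂ] H)} {p : H →L[ℂ] H}
    (hp : IsCentralProjection B p) {x : H →L[ℂ] H} :
    x ∈ directSummand B hp ↔ ∃ b ∈ B, x = b * p :=
  ⟨fun ⟨hx, hx'⟩ => ⟨x, hx, hx'.symm⟩, fun ⟨b, hb, hx⟩ => by
    subst hx
    exact ⟨mul_mem hb hp.mem, by rw [mul_assoc, hp.proj.isIdempotentElem.eq]⟩⟩

/-- `e` is a minimal (nonzero) projection of `B`: `e B e = ℂ e`. -/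
structure IsMinimalProjection (B : NonUnitalStarSubalgebra ℂ (H →L[ℂ] H)) (e : H →L[ℂ] H) :
    Prop where
  mem : e ∈ B
  proj : IsStarProjection e
  ne_zero : e ≠ 0
  minimal : ∀ x ∈ B, ∃ c : ℂ, e * x * e = c • e

/-- `B` is diffuse: it has no minimal projection. -/
def IsDiffuseAlgebra (B : NonUnitalStarSubalgebra ℂ (H →L[ℂ] H)) : Prop :=
  ∀ e, ¬ IsMinimalProjection B e

/-- `B` is atomic: its unit `u` is the sum, in the strong operator topology, of a family of mutually
orthogonal minimal projections of `B`. -/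
def IsAtomicAlgebra (B : NonUnitalStarSubalgebra ℂ (H →L[ℂ] H)) : Prop :=
  ∃ u ∈ B, (∀ x ∈ B, u * x = x ∧ x * u = x) ∧
    ∃ S : Set (H →L[ℂ] H), (∀ e ∈ S, IsMinimalProjection B e) ∧
      (S.Pairwise fun e f => e * f = 0) ∧
      ∀ ξ : H, HasSum (fun e : S => (e : H →L[ℂ] H) ξ) (u ξ)

/-- `A` is a maximal abelian ⋆-subalgebra of `B`: `A` is an abelian ⋆-subalgebra of `B` and
`A' ∩ B = A`. -/
structure IsMASA (A B : NonUnitalStarSubalgebra ℂ (H →L[ℂ] H)) : Prop where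
  le : A ≤ B
  comm : ∀ x ∈ A, ∀ y ∈ A, x * y = y * x
  maximal : ∀ x ∈ B, (∀ a ∈ A, a * x = x * a) → x ∈ A

/-- `B` is separable with respect to the seminorm `x ↦ ‖x Ω‖`. For the trace vector `Ω` this
is the Hilbert norm `‖x‖₂ = τ(x⋆ x)^{1/2}`. -/
def IsSeparableTwo (Ω : H) (B : Set (H →L[ℂ] H)) : Prop :=
  TopologicalSpace.IsSeparable ((fun x : H →L[ℂ] H => x Ω) '' B)

/-- Every nonzero direct summand `B p` of `B` is non-separable for the norm `x ↦ ‖x Ω‖`. -/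
def HasNoSeparableSummand (Ω : H) (B : NonUnitalStarSubalgebra ℂ (H →L[ℂ] H)) : Prop :=
  ∀ (p : H →L[ℂ] H) (hp : IsCentralProjection B p), p ≠ 0 →
    ¬ IsSeparableTwo Ω (directSummand B hp : Set (H →L[ℂ] H))

/-- The relative commutant (centralizer) `P' ∩ M`. -/
def relCommutant (P : VonNeumannAlgebra H) (M : StarSubalgebra ℂ (H →L[ℂ] H)) :
    NonUnitalStarSubalgebra ℂ (H →L[ℂ] H) :=
  (P.commutant.toStarSubalgebra ⊓ M).toNonUnitalStarSubalgebra

theorem mem_relCommutant_iff {P : VonNeumannAlgebra H} {M : StarSubalgebra ℂ (H →L[ℂ] H)}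
    {x : H →L[ℂ] H} : x ∈ relCommutant P M ↔ x ∈ M ∧ ∀ y ∈ P, y * x = x * y := by
  constructor
  · rintro ⟨h1, h2⟩
    exact ⟨h2, VonNeumannAlgebra.mem_commutant_iff.mp h1⟩
  · rintro ⟨h1, h2⟩
    exact ⟨VonNeumannAlgebra.mem_commutant_iff.mpr h2, h1⟩

end Algebras

end

/-! Let `B` be the relative commutant. The sum `q` of a maximal orthogonal family of minimal
projections of `B` is central: for `e` in the family and `b` in `B`, a nonzero `(1 - q) * b * e`
would have a minimal left support orthogonal to the family. So `B q` is atomic and `B (1 - q)` is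
diffuse (`exists_atomic_part`).

Non-separability rests on one fact (`exists_isMinimalProjection`): if `D` is separable, a nonzero
corner `C = p (D' ∩ M) p` that is separable has a minimal projection. By countable saturation the
unit ball of `C` is totally bounded in the 2-norm: otherwise some contraction of `C` would keep a
fixed distance from a dense sequence of that ball (`totallyBounded_ballImage`). Without minimal
projections, compactness of the ball would let every projection split into pieces of comparable
trace, and iterating this would give arbitrarily many uniformly separated projections.

A minimal projection of a summand of `B (1 - q)` is minimal in `B (1 - q)`, which is diffuse. For a
maximal abelian `A`, the summand `A p` is the corner given by `D = P ∪ A p`, and its minimal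
projections are again minimal in `B (1 - q)`.

The operator algebra needed follows from saturation, traciality and positive parts: the unit ball is
2-norm complete, and 2-norm convergence on it is strong convergence. -/

/-! ### Countably saturated tracial algebras of operators -/

section Saturated

variable {H : Type*} [NormedAddCommGroup H] [InnerProductSpace ℂ H] [CompleteSpace H]

/-- The properties of the ultraproduct, acting on its `L²`-space with trace vector `Ω`, that the
structure theory below uses: the vector state of `Ω` is tracial, `Ω` is cyclic, and the unit ball is
closed under positive parts and countably saturated for `‖·‖₂`-conditions. -/
structure IsSaturatedTracial (M : StarSubalgebra ℂ (H →L[ℂ] H)) (Ω : H) : Prop where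
  norm_star : ∀ x ∈ M, ‖star x Ω‖ = ‖x Ω‖
  dense : Dense ((fun x : H →L[ℂ] H => x Ω) '' (M : Set (H →L[ℂ] H)))
  posPart_mem : ∀ x ∈ M, IsSelfAdjoint x → x⁺ ∈ M
  saturated : ∀ (a b c : ℕ → H →L[ℂ] H) (G : ℕ → ℝ → ℝ), (∀ j, a j ∈ M) → (∀ j, b j ∈ M) →
    (∀ j, c j ∈ M) → (∀ j, Continuous (G j)) →
    (∀ k, ∃ x ∈ M, ‖x‖ ≤ 1 ∧ ∀ j < k, G j ‖(x * a j + b j * x + c j) Ω‖ ≤ 0) →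
    ∃ x ∈ M, ‖x‖ ≤ 1 ∧ ∀ j, G j ‖(x * a j + b j * x + c j) Ω‖ ≤ 0

/-- The `‖·‖₂`-image of the unit ball of a set of operators. -/
def ballImage (Ω : H) (C : Set (H →L[ℂ] H)) : Set H :=
  (fun x : H →L[ℂ] H => x Ω) '' {x | x ∈ C ∧ ‖x‖ ≤ 1}

/-- The adjoint is not strongly continuous. Inner products still give `star a * a = a` in the limit,
and this one identity makes `a` both self-adjoint and idempotent. -/
theorem IsStarProjection.of_tendsto {ι : Type*} {l : Filter ι} [l.NeBot] {x : ι → H →L[ℂ] H}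
    {a : H →L[ℂ] H} (hx : ∀ᶠ i in l, IsStarProjection (x i))
    (h : ∀ ξ, Tendsto (fun i => x i ξ) l (𝓝 (a ξ))) : IsStarProjection a := by
  have key : star a * a = a := by
    ext1 ξ
    refine ext_inner_right ℂ fun η => ?_
    rw [mul_apply_eq_comp, ContinuousLinearMap.star_eq_adjoint,
      ContinuousLinearMap.adjoint_inner_left]
    refine tendsto_nhds_unique ((h ξ).inner (h η)) ?_
    refine ((h ξ).inner (tendsto_const_nhds (x := η))).congr' ?_
    filter_upwards [hx] with i hi
    rw [← ContinuousLinearMap.adjoint_inner_left, ← ContinuousLinearMap.star_eq_adjoint,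
      hi.isSelfAdjoint.star_eq, ← mul_apply_eq_comp, hi.isIdempotentElem.eq]
  have hs : star a = a := by
    rw [← key, star_mul, star_star]
  exact ⟨by rw [IsIdempotentElem]; nth_rewrite 1 [← hs]; exact key, hs⟩

theorem norm_add_apply_sq {u v : H →L[ℂ] H} (h : star u * v = 0) (ξ : H) :
    ‖(u + v) ξ‖ ^ 2 = ‖u ξ‖ ^ 2 + ‖v ξ‖ ^ 2 := by
  have h0 : inner ℂ (u ξ) (v ξ) = 0 := by
    rw [← ContinuousLinearMap.adjoint_inner_right, ← ContinuousLinearMap.star_eq_adjoint,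
      ← mul_apply_eq_comp, h]
    simp
  have := norm_add_sq_eq_norm_sq_add_norm_sq_of_inner_eq_zero (𝕜 := ℂ) (u ξ) (v ξ) h0
  simpa [sq] using this

omit [CompleteSpace H] in
theorem IsSeparableTwo.exists_seq {Ω : H} {B : Set (H →L[ℂ] H)} (hB : IsSeparableTwo Ω B)
    (hne : B.Nonempty) :
    ∃ a : ℕ → H →L[ℂ] H, (∀ j, a j ∈ B) ∧ ∀ x ∈ B, ∀ ε > 0, ∃ j, ‖(x - a j) Ω‖ < ε := by
  obtain ⟨t, htB, htc, ht⟩ := hB.exists_countable_dense_subset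
  have htne : t.Nonempty := by
    rw [← closure_nonempty_iff]
    exact (hne.image _).mono ht
  obtain ⟨f, rfl⟩ := htc.exists_eq_range htne
  choose a ha haf using fun j => htB (Set.mem_range_self j)
  refine ⟨a, ha, fun x hx ε hε => ?_⟩
  obtain ⟨_, ⟨j, rfl⟩, hj⟩ := Metric.mem_closure_iff.mp (ht ⟨x, hx, rfl⟩) ε hε
  refine ⟨j, ?_⟩
  rw [dist_eq_norm, ← haf j] at hj
  simpa using hj

namespace IsSaturatedTracial

variable {M : StarSubalgebra ℂ (H →L[ℂ] H)} {Ω : H}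

/-- Passing to adjoints preserves the 2-norm and turns `y` into a left factor. Traciality enters the
structure theory only here. -/
theorem norm_mul_apply_le (hM : IsSaturatedTracial M Ω) {x y : H →L[ℂ] H} (hx : x ∈ M)
    (hy : y ∈ M) : ‖(x * y) Ω‖ ≤ ‖y‖ * ‖x Ω‖ := by
  rw [← hM.norm_star _ (mul_mem hx hy), ← hM.norm_star _ hx, star_mul, ← _root_.norm_star y]
  exact (star y).le_opNorm (star x Ω)

/-- On the dense vectors `y Ω` the difference is at most `‖y‖ * ‖(x i - a) Ω‖`; the uniform norm
bound extends this to all vectors. -/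
theorem tendsto_apply (hM : IsSaturatedTracial M Ω) {ι : Type*} {l : Filter ι}
    {x : ι → H →L[ℂ] H} {a : H →L[ℂ] H} (hx : ∀ i, x i ∈ M) (hx1 : ∀ i, ‖x i‖ ≤ 1) (ha : a ∈ M)
    (ha1 : ‖a‖ ≤ 1) (h : Tendsto (fun i => x i Ω) l (𝓝 (a Ω))) (ξ : H) :
    Tendsto (fun i => x i ξ) l (𝓝 (a ξ)) := by
  rw [Metric.tendsto_nhds]
  intro ε hε
  obtain ⟨_, hyξ, ⟨y, hy, rfl⟩⟩ := Metric.dense_iff.mp hM.dense ξ (ε / 4) (by positivity)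
  rw [Metric.mem_ball, dist_eq_norm] at hyξ
  have h1 : ∀ᶠ i in l, dist (x i Ω) (a Ω) < ε / (2 * (‖y‖ + 1)) :=
    Metric.tendsto_nhds.mp h _ (by positivity)
  filter_upwards [h1] with i hi
  rw [dist_eq_norm] at hi ⊢
  have e1 : x i ξ - a ξ = ((x i - a) * y) Ω - (x i (y Ω - ξ) - a (y Ω - ξ)) := by
    simp
    abel
  have e2 : ‖((x i - a) * y) Ω‖ ≤ ‖y‖ * ‖x i Ω - a Ω‖ := by
    simpa using hM.norm_mul_apply_le (sub_mem (hx i) ha) hy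
  have e3 : ‖x i (y Ω - ξ)‖ ≤ ‖y Ω - ξ‖ := by
    simpa using (x i).le_of_opNorm_le (hx1 i) (y Ω - ξ)
  have e4 : ‖a (y Ω - ξ)‖ ≤ ‖y Ω - ξ‖ := by
    simpa using a.le_of_opNorm_le ha1 (y Ω - ξ)
  have e5 : ‖y‖ * ‖x i Ω - a Ω‖ ≤ ε / 2 := by
    rw [lt_div_iff₀ (by positivity)] at hi
    nlinarith [norm_nonneg y, norm_nonneg (x i Ω - a Ω)]
  rw [e1]
  have e6 := norm_sub_le (((x i - a) * y) Ω) (x i (y Ω - ξ) - a (y Ω - ξ))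
  have e7 := norm_sub_le (x i (y Ω - ξ)) (a (y Ω - ξ))
  linarith

/-- The vector `Ω` is separating, so identities in `M` may be checked at `Ω`. -/
theorem eq_zero_of_apply_eq_zero (hM : IsSaturatedTracial M Ω) {x : H →L[ℂ] H} (hx : x ∈ M)
    (h : x Ω = 0) : x = 0 := by
  refine ContinuousLinearMap.coeFn_injective ?_
  refine Continuous.ext_on hM.dense x.continuous (by fun_prop) ?_
  rintro _ ⟨y, hy, rfl⟩
  have := hM.norm_mul_apply_le hx hy
  rw [h, norm_zero, mul_zero] at this
  simpa using this

theorem saturated_countable (hM : IsSaturatedTracial M Ω) {ι : Type*} [Countable ι] [Nonempty ι]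
    (a b c : ι → H →L[ℂ] H) (G : ι → ℝ → ℝ) (ha : ∀ j, a j ∈ M) (hb : ∀ j, b j ∈ M)
    (hc : ∀ j, c j ∈ M) (hG : ∀ j, Continuous (G j))
    (h : ∀ s : Set ι, s.Finite →
      ∃ x ∈ M, ‖x‖ ≤ 1 ∧ ∀ j ∈ s, G j ‖(x * a j + b j * x + c j) Ω‖ ≤ 0) :
    ∃ x ∈ M, ‖x‖ ≤ 1 ∧ ∀ j, G j ‖(x * a j + b j * x + c j) Ω‖ ≤ 0 := by
  obtain ⟨e, he⟩ := exists_surjective_nat ι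
  obtain ⟨x, hx, hx1, hxe⟩ := hM.saturated (a ∘ e) (b ∘ e) (c ∘ e) (G ∘ e) (fun _ => ha _)
    (fun _ => hb _) (fun _ => hc _) (fun _ => hG _) fun k => by
      obtain ⟨x, hx, hx1, hxs⟩ := h (e '' Set.Iio k) ((Set.finite_Iio k).image e)
      exact ⟨x, hx, hx1, fun j hj => hxs _ ⟨j, hj, rfl⟩⟩
  exact ⟨x, hx, hx1, he.forall.mpr hxe⟩

/-- Saturation yields completeness. If `x k Ω` is within `1 / (k + 1)` of `η`, then `x k` itself
satisfies `‖(y - x j) Ω‖ ≤ 2 / (j + 1)` for `j < k`, and a `y` satisfying all of these has `y Ω =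
η`. -/
theorem isClosed_ballImage (hM : IsSaturatedTracial M Ω) : IsClosed (ballImage Ω (M : Set _)) := by
  refine isClosed_of_closure_subset fun η hη => ?_
  have hk : ∀ k : ℕ, ∃ x ∈ M, ‖x‖ ≤ 1 ∧ dist η (x Ω) < 1 / (k + 1) := fun k => by
    obtain ⟨_, ⟨x, ⟨hx, hx1⟩, rfl⟩, h⟩ :=
      Metric.mem_closure_iff.mp hη (1 / (k + 1)) (by positivity)
    exact ⟨x, hx, hx1, h⟩
  choose x hx hx1 hd using hk
  obtain ⟨y, hy, hy1, hyx⟩ := hM.saturated (fun _ => 1) (fun _ => 0) (fun k => -x k)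
    (fun k t => t - 2 / (k + 1)) (fun _ => one_mem M) (fun _ => zero_mem M)
    (fun k => neg_mem (hx k)) (fun k => by fun_prop) fun k => by
      refine ⟨x k, hx k, hx1 k, fun j hj => ?_⟩
      have h1 := dist_triangle_left (x k Ω) (x j Ω) η
      have h2 : (1 : ℝ) / (k + 1) ≤ 1 / (j + 1) := by gcongr
      have h3 : (2 : ℝ) / (j + 1) = 1 / (j + 1) + 1 / (j + 1) := by ring
      rw [dist_eq_norm (x k Ω)] at h1
      have h4 := hd k
      have h5 := hd j
      simp only [mul_one, zero_mul, add_zero, ← sub_eq_add_neg, sub_apply]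
      linarith
  refine ⟨y, ⟨hy, hy1⟩, ?_⟩
  refine eq_of_forall_dist_le fun ε hε => ?_
  obtain ⟨k, hk⟩ := exists_nat_one_div_lt (show 0 < ε / 3 by positivity)
  have h1 := hyx k
  simp only [mul_one, zero_mul, add_zero, ← sub_eq_add_neg, sub_apply] at h1
  rw [← dist_eq_norm] at h1
  have h2 := dist_triangle_right (y Ω) η (x k Ω)
  have h3 : (2 : ℝ) / (k + 1) = 1 / (k + 1) + 1 / (k + 1) := by ring
  have h4 := hd k
  simp only
  linarith

end IsSaturatedTracial

end Saturated

/-! ### Corners of relative commutants: strong limits and spectral projections. -/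

section CornerCommutant

variable {H : Type*} [NormedAddCommGroup H] [InnerProductSpace ℂ H] [CompleteSpace H]

/-- `C` is the corner `p (D' ∩ M) p` of a relative commutant. -/
def IsCornerCommutant (M : StarSubalgebra ℂ (H →L[ℂ] H)) (D : Set (H →L[ℂ] H)) (p : H →L[ℂ] H)
    (C : NonUnitalStarSubalgebra ℂ (H →L[ℂ] H)) : Prop :=
  ∀ x, x ∈ C ↔ x ∈ M ∧ (∀ d ∈ D, d * x = x * d) ∧ p * x = x ∧ x * p = x

/-- Since `a * a⁺ = a⁺ * a⁺`, the operator `f` fixes the square of `a⁺`, and the C⋆-identity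
descends to `a⁺`. Nothing is assumed of `f` beyond `f * a = a`. -/
theorem mul_eq_self_of_posPart {a f : H →L[ℂ] H} (ha : IsSelfAdjoint a) (hfa : f * a = a) :
    f * a⁺ = a⁺ := by
  have h1 : a * a⁺ = a⁺ * a⁺ := by
    nth_rewrite 1 [← CFC.posPart_sub_negPart a ha]
    rw [sub_mul, CFC.negPart_mul_posPart, sub_zero]
  have hs : star (a⁺) = a⁺ := (CFC.posPart_nonneg a).isSelfAdjoint.star_eq
  have h2 : (f * a⁺ - a⁺) * star (f * a⁺ - a⁺) = 0 := by
    rw [star_sub, star_mul, hs]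
    have : (f * a⁺ - a⁺) * (a⁺ * star f - a⁺) = (f * (a⁺ * a⁺) - a⁺ * a⁺) * (star f - 1) := by
      noncomm_ring
    rw [this, ← h1, ← mul_assoc, hfa, sub_self, zero_mul]
  exact sub_eq_zero.mp (CStarRing.mul_star_self_eq_zero_iff _ |>.mp h2)

theorem apply_eq_zero_of_re_inner_eq_zero {b : H →L[ℂ] H} (hb : 0 ≤ b) {ξ : H}
    (h : (inner ℂ ξ (b ξ)).re = 0) : b ξ = 0 := by
  obtain ⟨s, rfl⟩ := CStarAlgebra.nonneg_iff_eq_star_mul_self.mp hb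
  rw [mul_apply_eq_comp, ContinuousLinearMap.star_eq_adjoint,
    ContinuousLinearMap.adjoint_inner_right, inner_self_eq_norm_sq_to_K] at h
  have h' : ‖s ξ‖ ^ 2 = 0 := by exact_mod_cast h
  rw [mul_apply_eq_comp, norm_eq_zero.mp (pow_eq_zero_iff two_ne_zero |>.mp h'), map_zero]

/-- For a selfadjoint contraction `y`, the vectors `y²ⁿ ξ` converge. -/
theorem cauchySeq_mul_self_pow_apply {y : H →L[ℂ] H} (hy : IsSelfAdjoint y) (hy1 : ‖y‖ ≤ 1)
    (ξ : H) : CauchySeq fun n : ℕ => ((y * y) ^ (n + 1)) ξ := by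
  have hanti : Antitone fun k : ℕ => ‖(y ^ k) ξ‖ ^ 2 := by
    refine antitone_nat_of_succ_le fun k => ?_
    have : ‖(y ^ (k + 1)) ξ‖ ≤ ‖(y ^ k) ξ‖ := by
      rw [pow_succ', mul_apply_eq_comp]
      simpa using y.le_of_opNorm_le hy1 ((y ^ k) ξ)
    gcongr
  have hbdd : BddBelow (Set.range fun k : ℕ => ‖(y ^ k) ξ‖ ^ 2) :=
    ⟨0, by rintro _ ⟨k, rfl⟩; positivity⟩
  have hlim := tendsto_atTop_ciInf hanti hbdd
  set L := ⨅ k : ℕ, ‖(y ^ k) ξ‖ ^ 2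
  -- As `y` is self-adjoint, these inner products depend only on the sum of the exponents. With `s k
  -- = ‖(y ^ k) ξ‖ ^ 2`, a decreasing sequence, the squared distances become `s (2n) - 2 s (n + m) +
  -- s (2m)`, which tends to zero.
  have hinner : ∀ n m : ℕ, inner ℂ ((y ^ (2 * n)) ξ) ((y ^ (2 * m)) ξ) =
      ((‖(y ^ (n + m)) ξ‖ ^ 2 : ℝ) : ℂ) := fun n m => by
    have e : ∀ a b : ℕ, inner ℂ ((y ^ a) ξ) ((y ^ b) ξ) = inner ℂ ξ ((y ^ (a + b)) ξ) := by
      intro a b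
      rw [pow_add, mul_apply_eq_comp, ← ContinuousLinearMap.adjoint_inner_right,
        ← ContinuousLinearMap.star_eq_adjoint, star_pow, hy.star_eq]
    rw [e, show 2 * n + 2 * m = (n + m) + (n + m) by ring, ← e, inner_self_eq_norm_sq_to_K]
    norm_cast
  have hsq : ∀ n m : ℕ, ‖((y * y) ^ n) ξ - ((y * y) ^ m) ξ‖ ^ 2 =
      ‖(y ^ (2 * n)) ξ‖ ^ 2 - 2 * ‖(y ^ (n + m)) ξ‖ ^ 2 + ‖(y ^ (2 * m)) ξ‖ ^ 2 := fun n m => by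
    rw [← pow_two, ← pow_mul, ← pow_mul, norm_sub_sq (𝕜 := ℂ), hinner]
    simp only [RCLike.re_to_complex, Complex.ofReal_re]
  rw [Metric.cauchySeq_iff]
  intro ε hε
  obtain ⟨N, hN⟩ := Metric.tendsto_atTop.mp hlim (ε ^ 2 / 8) (by positivity)
  refine ⟨N, fun m hm n hn => ?_⟩
  rw [dist_eq_norm]
  refine lt_of_pow_lt_pow_left₀ 2 hε.le ?_
  rw [hsq]
  have h1 := hN (2 * (m + 1)) (by omega)
  have h2 := hN (m + 1 + (n + 1)) (by omega)
  have h3 := hN (2 * (n + 1)) (by omega)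
  rw [Real.dist_eq, abs_lt] at h1 h2 h3
  nlinarith [sq_pos_of_pos hε]

namespace IsCornerCommutant

variable {M : StarSubalgebra ℂ (H →L[ℂ] H)} {Ω : H} {D : Set (H →L[ℂ] H)} {p : H →L[ℂ] H}
  {C : NonUnitalStarSubalgebra ℂ (H →L[ℂ] H)}

theorem mem_of_mem (hC : IsCornerCommutant M D p C) {x : H →L[ℂ] H} (hx : x ∈ C) : x ∈ M :=
  ((hC x).mp hx).1

theorem of_tendsto (hC : IsCornerCommutant M D p C) {ι : Type*} {l : Filter ι} [l.NeBot]
    {x : ι → H →L[ℂ] H} {a : H →L[ℂ] H} (hx : ∀ i, x i ∈ C) (ha : a ∈ M)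
    (h : ∀ ξ, Tendsto (fun i => x i ξ) l (𝓝 (a ξ))) : a ∈ C := by
  refine (hC a).mpr ⟨ha, fun d hd => ?_, ?_, ?_⟩
  · ext1 ξ
    refine tendsto_nhds_unique ((d.continuous.tendsto _).comp (h ξ)) ?_
    refine (h (d ξ)).congr fun i => ?_
    exact congrArg (fun z : H →L[ℂ] H => z ξ) (((hC _).mp (hx i)).2.1 d hd).symm
  · ext1 ξ
    refine tendsto_nhds_unique ((p.continuous.tendsto _).comp (h ξ)) ?_
    refine (h ξ).congr fun i => ?_
    exact congrArg (fun z : H →L[ℂ] H => z ξ) (((hC _).mp (hx i)).2.2.1).symm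
  · ext1 ξ
    refine tendsto_nhds_unique (h (p ξ)) ?_
    refine (h ξ).congr fun i => ?_
    exact congrArg (fun z : H →L[ℂ] H => z ξ) (((hC _).mp (hx i)).2.2.2).symm

/-- Completeness of the ball of `M` supplies the operator, convergence at `Ω` upgrades to strong
convergence, and the equations defining `C` survive it. This replaces weak closedness in
constructing spectral projections, infinite sums and extremal subprojections. -/
theorem exists_of_tendsto (hM : IsSaturatedTracial M Ω) (hC : IsCornerCommutant M D p C)
    {ι : Type*} {l : Filter ι} [l.NeBot] {x : ι → H →L[ℂ] H} {η : H} (hx : ∀ i, x i ∈ C)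
    (hx1 : ∀ i, ‖x i‖ ≤ 1) (h : Tendsto (fun i => x i Ω) l (𝓝 η)) :
    ∃ a ∈ C, ‖a‖ ≤ 1 ∧ a Ω = η ∧ ∀ ξ, Tendsto (fun i => x i ξ) l (𝓝 (a ξ)) := by
  obtain ⟨a, ⟨ha, ha1⟩, haη⟩ := hM.isClosed_ballImage.mem_of_tendsto h
    (Eventually.of_forall fun i => ⟨x i, ⟨hC.mem_of_mem (hx i), hx1 i⟩, rfl⟩)
  simp only at haη
  have h' := hM.tendsto_apply (fun i => hC.mem_of_mem (hx i)) hx1 ha ha1 (haη ▸ h)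
  exact ⟨a, hC.of_tendsto hx ha h', ha1, haη, h'⟩

theorem isClosed_ballImage (hM : IsSaturatedTracial M Ω) (hC : IsCornerCommutant M D p C) :
    IsClosed (ballImage Ω (C : Set _)) := by
  refine isClosed_of_closure_subset fun η hη => ?_
  obtain ⟨u, hu, hlim⟩ := mem_closure_iff_seq_limit.mp hη
  choose x hx hxu using hu
  obtain ⟨a, ha, ha1, haη, -⟩ := hC.exists_of_tendsto hM (fun i => (hx i).1) (fun i => (hx i).2)
    (hlim.congr fun i => (hxu i).symm)
  exact ⟨a, ⟨ha, ha1⟩, haη⟩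

theorem posPart_mem (hM : IsSaturatedTracial M Ω) (hC : IsCornerCommutant M D p C)
    (hp : IsSelfAdjoint p) {a : H →L[ℂ] H} (ha : a ∈ C) (hs : IsSelfAdjoint a) : a⁺ ∈ C := by
  obtain ⟨h1, h2, h3, h4⟩ := (hC a).mp ha
  have h5 : p * a⁺ = a⁺ := mul_eq_self_of_posPart hs h3
  refine (hC _).mpr ⟨hM.posPart_mem a h1 hs, fun d hd => ?_, h5, ?_⟩
  · exact ((show Commute a d from (h2 d hd).symm).cfcₙ_real _).eq.symm
  · have := congrArg star h5
    rwa [star_mul, hp.star_eq, (CFC.posPart_nonneg a).isSelfAdjoint.star_eq] at this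

/-- The projection onto the eigenspace `y² = 1` of a selfadjoint contraction `y`. -/
theorem exists_fixed_projection (hM : IsSaturatedTracial M Ω) (hC : IsCornerCommutant M D p C)
    {y : H →L[ℂ] H} (hy : y ∈ C) (hs : IsSelfAdjoint y) (hy1 : ‖y‖ ≤ 1) :
    ∃ e ∈ C, IsStarProjection e ∧ y * y * e = e ∧ (∀ w, y * y * w = w → e * w = w) ∧
      ∀ f, f * y = y → f * e = e := by
  -- The exponents start at one because `C` need not contain the identity operator.
  have hpow : ∀ n : ℕ, (y * y) ^ (n + 1) ∈ C := fun n => by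
    induction n with
    | zero => simpa using mul_mem hy hy
    | succ n ih => rw [pow_succ]; exact mul_mem ih (mul_mem hy hy)
  have hnorm : ∀ n : ℕ, ‖(y * y) ^ (n + 1)‖ ≤ 1 := fun n => by
    refine (norm_pow_le' _ n.succ_pos).trans (pow_le_one₀ (norm_nonneg _) ?_)
    exact (norm_mul_le _ _).trans (mul_le_one₀ hy1 (norm_nonneg _) hy1)
  obtain ⟨η, hη⟩ := cauchySeq_tendsto_of_complete (cauchySeq_mul_self_pow_apply hs hy1 Ω)
  obtain ⟨e, he, -, -, hlim⟩ := hC.exists_of_tendsto hM hpow hnorm hη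
  have hz : IsSelfAdjoint (y * y) := by
    rw [IsSelfAdjoint, star_mul, hs.star_eq]
  have key : star e * e = e := by
    ext1 ξ
    refine ext_inner_left ℂ fun ζ => ?_
    rw [mul_apply_eq_comp, ContinuousLinearMap.star_eq_adjoint,
      ContinuousLinearMap.adjoint_inner_right]
    refine tendsto_nhds_unique ((hlim ζ).inner (hlim ξ)) ?_
    -- At index `2 * n + 1` the exponent is `2 * n + 2`, twice the exponent at index `n`.
    have h2 : Tendsto (fun n : ℕ => 2 * n + 1) atTop atTop :=
      tendsto_atTop_mono (fun n => by simp only [id]; omega) tendsto_id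
    refine ((tendsto_const_nhds (x := ζ)).inner ((hlim ξ).comp h2)).congr fun n => ?_
    simp only [Function.comp]
    rw [← ContinuousLinearMap.adjoint_inner_right, ← ContinuousLinearMap.star_eq_adjoint,
      star_pow, hz.star_eq, ← mul_apply_eq_comp, ← pow_add]
    congr 3
    ring
  have hse : star e = e := by
    rw [← key, star_mul, star_star]
  refine ⟨e, he, ⟨by rw [IsIdempotentElem]; nth_rewrite 1 [← hse]; exact key, hse⟩, ?_, ?_, ?_⟩
  · ext1 ξ
    refine tendsto_nhds_unique (((y * y).continuous.tendsto _).comp (hlim ξ)) ?_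
    refine ((hlim ξ).comp (tendsto_add_atTop_nat 1)).congr fun n => ?_
    simp only [Function.comp]
    rw [pow_succ' _ (n + 1), mul_apply_eq_comp]
  · intro w hw
    have hw' : ∀ n : ℕ, (y * y) ^ (n + 1) * w = w := fun n => by
      induction n with
      | zero => simpa using hw
      | succ n ih => rw [pow_succ, mul_assoc, hw, ih]
    ext1 ξ
    refine tendsto_nhds_unique (hlim (w ξ)) ?_
    refine tendsto_const_nhds.congr fun n => ?_
    exact congrArg (fun z : H →L[ℂ] H => z ξ) (hw' n).symm
  · intro f hf
    ext1 ξ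
    refine tendsto_nhds_unique ((f.continuous.tendsto _).comp (hlim ξ)) ?_
    refine (hlim ξ).congr fun n => ?_
    have : f * (y * y) ^ (n + 1) = (y * y) ^ (n + 1) := by
      rw [pow_succ', ← mul_assoc, ← mul_assoc, hf]
    exact congrArg (fun z : H →L[ℂ] H => z ξ) this.symm

end IsCornerCommutant

end CornerCommutant

/-! ### Splitting non-minimal projections, and total boundedness from saturation. -/

section MinimalProjection

variable {H : Type*} [NormedAddCommGroup H] [InnerProductSpace ℂ H] [CompleteSpace H]

/-- With `r = f * x * f`, if `r + star r` and `I • (r - star r)` were the multiples `c • f` and `d •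
f`, then `r` would be `(c / 2 - I * d / 2) • f`. -/
theorem exists_isSelfAdjoint_not_scalar {C : NonUnitalStarSubalgebra ℂ (H →L[ℂ] H)}
    {f x : H →L[ℂ] H} (hf : f ∈ C) (hfp : IsStarProjection f) (hx : x ∈ C)
    (h : ∀ c : ℂ, f * x * f ≠ c • f) :
    ∃ a ∈ C, IsSelfAdjoint a ∧ f * a = a ∧ ∀ c : ℂ, a ≠ c • f := by
  have hff := hfp.isIdempotentElem.eq
  have hfs := hfp.isSelfAdjoint.star_eq
  set r := f * x * f with hr
  have hrC : r ∈ C := mul_mem (mul_mem hf hx) hf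
  have hfr : f * r = r := by rw [hr, ← mul_assoc, ← mul_assoc, hff]
  have hfr' : f * star r = star r := by
    rw [hr, star_mul, star_mul, hfs, ← mul_assoc, hff]
  by_contra! hcon
  obtain ⟨c, hc⟩ := hcon (r + star r) (add_mem hrC (star_mem hrC))
    (by rw [IsSelfAdjoint, star_add, star_star, add_comm]) (by rw [mul_add, hfr, hfr'])
  obtain ⟨d, hd⟩ := hcon (Complex.I • (r - star r))
    (SMulMemClass.smul_mem _ (sub_mem hrC (star_mem hrC)))
    (by
      rw [IsSelfAdjoint, star_smul, star_sub, star_star]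
      simp only [RCLike.star_def, Complex.conj_I, neg_smul, ← smul_neg, neg_sub])
    (by rw [mul_smul_comm, mul_sub, hfr, hfr'])
  refine h ((1 / 2 : ℂ) * c - (1 / 2 : ℂ) * Complex.I * d) ?_
  rw [sub_smul, mul_smul, mul_smul, ← hc, ← hd, smul_smul]
  have : (1 / 2 : ℂ) * Complex.I * Complex.I = -(1 / 2) := by
    rw [mul_assoc, Complex.I_mul_I]; ring
  rw [this]
  module

namespace IsCornerCommutant

variable {M : StarSubalgebra ℂ (H →L[ℂ] H)} {Ω : H} {D : Set (H →L[ℂ] H)} {p : H →L[ℂ] H}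
  {C : NonUnitalStarSubalgebra ℂ (H →L[ℂ] H)}

/-- A nonzero projection that is not minimal splits. -/
theorem exists_proper_subprojection (hM : IsSaturatedTracial M Ω) (hC : IsCornerCommutant M D p C)
    (hp : IsSelfAdjoint p) {f : H →L[ℂ] H} (hf : f ∈ C) (hfp : IsStarProjection f) (hf0 : f ≠ 0)
    (hmin : ¬ IsMinimalProjection C f) :
    ∃ e ∈ C, IsStarProjection e ∧ f * e = e ∧ e ≠ 0 ∧ e ≠ f := by
  have hff := hfp.isIdempotentElem.eq
  have hfs := hfp.isSelfAdjoint.star_eq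
  have hex : ∃ x ∈ C, ∀ c : ℂ, f * x * f ≠ c • f := by
    by_contra! hcon
    exact hmin ⟨hf, hfp, hf0, hcon⟩
  obtain ⟨x, hx, hxf⟩ := hex
  obtain ⟨a₀, ha₀, hs₀, hfa₀, hne⟩ := exists_isSelfAdjoint_not_scalar hf hfp hx hxf
  have hΩ : f Ω ≠ 0 := fun h => hf0 (hM.eq_zero_of_apply_eq_zero (hC.mem_of_mem hf) h)
  have hfin : inner ℂ Ω (f Ω) = ((‖f Ω‖ ^ 2 : ℝ) : ℂ) := by
    nth_rewrite 1 [← hff]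
    nth_rewrite 1 [← hfs]
    rw [mul_apply_eq_comp, ContinuousLinearMap.star_eq_adjoint,
      ContinuousLinearMap.adjoint_inner_right, inner_self_eq_norm_sq_to_K]
    norm_cast
  -- This shift gives `a` trace zero, so `a⁺` and `a⁻` have equal trace; as `a ≠ 0`, neither
  -- vanishes.
  set t : ℝ := (inner ℂ Ω (a₀ Ω)).re / ‖f Ω‖ ^ 2 with ht
  set a := a₀ - (t : ℂ) • f with ha
  have haC : a ∈ C := sub_mem ha₀ (SMulMemClass.smul_mem _ hf)
  have hs : IsSelfAdjoint a := hs₀.sub (by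
    rw [IsSelfAdjoint, star_smul, hfs, RCLike.star_def, Complex.conj_ofReal])
  have hfa : f * a = a := by rw [ha, mul_sub, hfa₀, mul_smul_comm, hff]
  have ha0 : a ≠ 0 := fun h => hne t (sub_eq_zero.mp h)
  have htr : (inner ℂ Ω (a Ω)).re = 0 := by
    have : ‖f Ω‖ ^ 2 ≠ 0 := by simpa using hΩ
    rw [ha, sub_apply, smul_apply, inner_sub_right, inner_smul_right, hfin, ← Complex.ofReal_mul,
      Complex.sub_re, Complex.ofReal_re, ht, div_mul_cancel₀ _ this, sub_self]
  have hpn := CFC.posPart_sub_negPart a hs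
  have hposC : a⁺ ∈ C := hC.posPart_mem hM hp haC hs
  have hnegC : a⁻ ∈ C := by
    rw [← CFC.posPart_neg]
    exact hC.posPart_mem hM hp (neg_mem haC) hs.neg
  have hbal : (inner ℂ Ω (a⁺ Ω)).re = (inner ℂ Ω (a⁻ Ω)).re := by
    have h := htr
    rw [← hpn, sub_apply, inner_sub_right, Complex.sub_re, sub_eq_zero] at h
    exact h
  have hzero : a⁺ = 0 ↔ a⁻ = 0 := by
    constructor
    · intro h
      refine hM.eq_zero_of_apply_eq_zero (hC.mem_of_mem hnegC)
        (apply_eq_zero_of_re_inner_eq_zero (CFC.negPart_nonneg a) ?_)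
      rw [← hbal, h]; simp
    · intro h
      refine hM.eq_zero_of_apply_eq_zero (hC.mem_of_mem hposC)
        (apply_eq_zero_of_re_inner_eq_zero (CFC.posPart_nonneg a) ?_)
      rw [hbal, h]; simp
  have hpos0 : a⁺ ≠ 0 := fun h => ha0 (by rw [← hpn, h, hzero.mp h, sub_zero])
  have hneg0 : a⁻ ≠ 0 := fun h => hpos0 (hzero.mpr h)
  have hfpos : f * a⁺ = a⁺ := mul_eq_self_of_posPart hs hfa
  have hfneg : f * a⁻ = a⁻ := by
    rw [← CFC.posPart_neg]
    exact mul_eq_self_of_posPart hs.neg (by rw [mul_neg, hfa])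
  have hposs : star (a⁺) = a⁺ := (CFC.posPart_nonneg a).isSelfAdjoint.star_eq
  have hposf : a⁺ * f = a⁺ := by
    have := congrArg star hfpos
    rwa [star_mul, hfs, hposs] at this
  have hn : 0 < ‖a⁺‖ := norm_pos_iff.mpr hpos0
  -- The subprojection is the fixed projection of `(f - b) ^ 2`. It is nonzero because `f - b` fixes
  -- `a⁻`; if it were `f`, then `b * b = 2 • b`, contradicting `‖b * b‖ = ‖b‖ = 1`.
  set b : H →L[ℂ] H := ((‖a⁺‖⁻¹ : ℝ) : ℂ) • a⁺ with hb
  have hbC : b ∈ C := SMulMemClass.smul_mem _ hposC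
  have hbn : ‖b‖ = 1 := by
    rw [hb, norm_smul, Complex.norm_real, norm_inv, norm_norm, inv_mul_cancel₀ hn.ne']
  have hb0 : 0 ≤ b := smul_nonneg (by exact_mod_cast inv_nonneg.mpr hn.le) (CFC.posPart_nonneg a)
  have hbs : star b = b := hb0.isSelfAdjoint.star_eq
  have hfb : f * b = b := by rw [hb, mul_smul_comm, hfpos]
  have hbf : b * f = b := by rw [hb, smul_mul_assoc, hposf]
  have hb1 : b ≤ 1 := (CStarAlgebra.norm_le_one_iff_of_nonneg b hb0).mp hbn.le
  have h1b : ‖1 - b‖ ≤ 1 := (CStarAlgebra.norm_le_one_iff_of_nonneg _ (sub_nonneg.mpr hb1)).mpr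
    (sub_le_self _ hb0)
  have hy1 : ‖f - b‖ ≤ 1 := by
    have : f - b = f * (1 - b) := by rw [mul_sub, mul_one, hfb]
    rw [this]
    exact (norm_mul_le _ _).trans (mul_le_one₀ hfp.norm_le (norm_nonneg _) h1b)
  obtain ⟨e, he, hep, hye, hfix, hcut⟩ := hC.exists_fixed_projection hM (sub_mem hf hbC)
    (hfp.isSelfAdjoint.sub hbs) hy1
  refine ⟨e, he, hep, hcut f (by rw [mul_sub, hff, hfb]), ?_, ?_⟩
  · rintro rfl
    have h1 : (f - b) * a⁻ = a⁻ := by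
      rw [sub_mul, hfneg, hb, smul_mul_assoc, CFC.posPart_mul_negPart, smul_zero, sub_zero]
    have h2 := hfix (a⁻) (by rw [mul_assoc, h1, h1])
    rw [zero_mul] at h2
    exact hneg0 h2.symm
  · rintro rfl
    have h1 : b * b = (2 : ℂ) • b := by
      have h3 : (e - b) * (e - b) * e = e * e * e - e * b * e - b * e * e + b * b * e := by
        noncomm_ring
      rw [h3, hff, hff, hfb, hbf, hbf, mul_assoc, hbf] at hye
      have h4 : b * b = b + b + ((e - b - b + b * b) - e) := by abel
      rw [h4, hye, sub_self, add_zero, two_smul]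
    have h2 : ‖b * b‖ = 1 := by
      have := CStarRing.norm_star_mul_self (x := b)
      rwa [hbs, hbn, mul_one] at this
    rw [h1, norm_smul, hbn] at h2
    norm_num at h2

/-- Saturation: a separable corner of the relative commutant of a separable set has a totally
bounded unit ball. -/
theorem totallyBounded_ballImage (hM : IsSaturatedTracial M Ω) (hC : IsCornerCommutant M D p C)
    (hDM : ∀ d ∈ D, d ∈ M) (hDne : D.Nonempty) (hD : IsSeparableTwo Ω D) (hp : p ∈ M)
    (hCs : IsSeparableTwo Ω (C : Set (H →L[ℂ] H))) :
    TotallyBounded (ballImage Ω (C : Set (H →L[ℂ] H))) := by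
  rw [Metric.totallyBounded_iff]
  by_contra! hcon
  obtain ⟨ε, hε, hfar⟩ := hcon
  obtain ⟨d, hdD, hd⟩ := hD.exists_seq hDne
  have hBs : IsSeparableTwo Ω {x | x ∈ (C : Set (H →L[ℂ] H)) ∧ ‖x‖ ≤ 1} :=
    hCs.mono (Set.image_mono fun x hx => hx.1)
  obtain ⟨b, hbC, hb⟩ := hBs.exists_seq ⟨0, zero_mem C, by simp⟩
  -- The conditions are `x * d j = d j * x`, `‖(x - b j) Ω‖ ≥ ε`, `p * x = x` (`true`) and `x * p =
  -- x` (`false`). Equations use `G t = t`, lower bounds `G t = ε - t`. Finitely many can be met: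
  -- the `ε`-balls around finitely many `b j Ω` miss some point of the ball of `C`.
  obtain ⟨x, hx, hx1, hxG⟩ := hM.saturated_countable (ι := (ℕ ⊕ ℕ) ⊕ Bool)
    (Sum.elim (Sum.elim d fun _ => 1) fun β => if β then -1 else p)
    (Sum.elim (Sum.elim (fun j => -d j) fun _ => 0) fun β => if β then p else -1)
    (Sum.elim (Sum.elim (fun _ => 0) fun j => -b j) fun _ => 0)
    (Sum.elim (Sum.elim (fun _ t => t) fun _ t => ε - t) fun _ t => t)
    (by
      rintro ((j | j) | β)
      · exact hDM _ (hdD j)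
      · exact one_mem M
      · cases β
        · exact hp
        · exact neg_mem (one_mem M))
    (by
      rintro ((j | j) | β)
      · exact neg_mem (hDM _ (hdD j))
      · exact zero_mem M
      · cases β
        · exact neg_mem (one_mem M)
        · exact hp)
    (by
      rintro ((j | j) | β)
      · exact zero_mem M
      · exact neg_mem (hC.mem_of_mem (hbC j).1)
      · exact zero_mem M)
    (by rintro ((j | j) | β) <;> simp <;> fun_prop)
    (by
      intro s hs
      have hfin : ((fun j => b j Ω) '' {j | Sum.inl (Sum.inr j) ∈ s}).Finite := by
        refine Set.Finite.image _ (hs.preimage ?_)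
        exact (Sum.inl_injective.comp Sum.inr_injective).injOn
      obtain ⟨_, ⟨x, ⟨hx, hx1⟩, rfl⟩, hxfar⟩ := Set.not_subset.mp (hfar _ hfin)
      obtain ⟨h1, h2, h3, h4⟩ := (hC x).mp hx
      refine ⟨x, h1, hx1, ?_⟩
      rintro ((j | j) | β) hj
      · simp [h2 _ (hdD j)]
      · simp only [Sum.elim_inl, Sum.elim_inr, mul_one, zero_mul, add_zero, ← sub_eq_add_neg,
          sub_apply, tsub_le_iff_right, zero_add, ← dist_eq_norm]
        by_contra! hlt
        exact hxfar (Set.mem_biUnion ⟨j, hj, rfl⟩ hlt)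
      · cases β
        · simp [h4]
        · simp [h3])
  have hcomm : ∀ y ∈ D, y * x = x * y := by
    intro y hy
    have hyM := hDM y hy
    refine sub_eq_zero.mp (hM.eq_zero_of_apply_eq_zero (sub_mem (mul_mem hyM hx) (mul_mem hx hyM))
      (norm_eq_zero.mp (le_antisymm (le_of_forall_pos_le_add fun δ hδ => ?_) (norm_nonneg _))))
    obtain ⟨j, hj⟩ := hd y hy (δ / 2) (by positivity)
    have h0 : x * d j - d j * x = 0 := by
      have h := hxG (Sum.inl (Sum.inl j))
      simp only [Sum.elim_inl, neg_mul, add_zero, norm_le_zero_iff, ← sub_eq_add_neg] at h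
      exact hM.eq_zero_of_apply_eq_zero
        (sub_mem (mul_mem hx (hDM _ (hdD j))) (mul_mem (hDM _ (hdD j)) hx)) h
    have h1 : y * x - x * y = (y - d j) * x - x * (y - d j) := by
      rw [← add_zero (y * x - x * y), ← h0, sub_mul, mul_sub]
      abel
    have h2 : ‖((y - d j) * x) Ω‖ ≤ ‖(y - d j) Ω‖ :=
      (hM.norm_mul_apply_le (sub_mem hyM (hDM _ (hdD j))) hx).trans
        (mul_le_of_le_one_left (norm_nonneg _) hx1)
    have h3 : ‖(x * (y - d j)) Ω‖ ≤ ‖(y - d j) Ω‖ := by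
      simpa using x.le_of_opNorm_le hx1 ((y - d j) Ω)
    rw [h1, sub_apply]
    refine (norm_sub_le _ _).trans ?_
    linarith
  have hpx : p * x = x := by
    have h := hxG (Sum.inr true)
    simp only [Sum.elim_inr, if_true, mul_neg, mul_one, add_zero, norm_le_zero_iff] at h
    rw [neg_add_eq_sub] at h
    exact sub_eq_zero.mp (hM.eq_zero_of_apply_eq_zero (sub_mem (mul_mem hp hx) hx) h)
  have hxp : x * p = x := by
    have h := hxG (Sum.inr false)
    simp only [Sum.elim_inr, Bool.false_eq_true, if_false, neg_mul, one_mul, add_zero,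
      norm_le_zero_iff, ← sub_eq_add_neg] at h
    exact sub_eq_zero.mp (hM.eq_zero_of_apply_eq_zero (sub_mem (mul_mem hx hp) hx) h)
  -- The solution lies in the unit ball of `C`, where the `b j` are dense, yet it stays `ε` away
  -- from each.
  obtain ⟨j, hj⟩ := hb x ⟨(hC x).mpr ⟨hx, hcomm, hpx, hxp⟩, hx1⟩ ε hε
  have h := hxG (Sum.inl (Sum.inr j))
  simp only [Sum.elim_inl, Sum.elim_inr, mul_one, zero_mul, add_zero, ← sub_eq_add_neg] at h
  linarith

end IsCornerCommutant

end MinimalProjection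

/-! ### Minimal projections from compactness of the unit ball. -/

section Compactness

variable {H : Type*} [NormedAddCommGroup H] [InnerProductSpace ℂ H] [CompleteSpace H]

theorem IsStarProjection.mul_eq_right_comm {e f : H →L[ℂ] H} (he : IsStarProjection e)
    (hf : IsStarProjection f) (h : f * e = e) : e * f = e := by
  have := congrArg star h
  rwa [star_mul, he.isSelfAdjoint.star_eq, hf.isSelfAdjoint.star_eq] at this

theorem norm_apply_sq_eq_add_sub {e f : H →L[ℂ] H} (he : IsStarProjection e)
    (h : f * e = e) (hf : IsStarProjection f) (ξ : H) :
    ‖f ξ‖ ^ 2 = ‖e ξ‖ ^ 2 + ‖(f - e) ξ‖ ^ 2 := by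
  have := norm_add_apply_sq (u := e) (v := f - e) (by
    rw [he.isSelfAdjoint.star_eq, mul_sub, he.mul_eq_right_comm hf h, he.isIdempotentElem.eq,
      sub_self]) ξ
  rwa [add_sub_cancel] at this

namespace IsCornerCommutant

variable {M : StarSubalgebra ℂ (H →L[ℂ] H)} {Ω : H} {D : Set (H →L[ℂ] H)} {p : H →L[ℂ] H}
  {C : NonUnitalStarSubalgebra ℂ (H →L[ℂ] H)}

/-- If the unit ball is compact and there are no minimal projections, every nonzero projection has
a subprojection of between one third and two thirds of its trace. -/
theorem exists_subprojection_thirds (hM : IsSaturatedTracial M Ω) (hC : IsCornerCommutant M D p C)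
    (hp : IsSelfAdjoint p) (hK : IsCompact (ballImage Ω (C : Set (H →L[ℂ] H))))
    (hmin : ∀ e, ¬ IsMinimalProjection C e) {f : H →L[ℂ] H} (hf : f ∈ C)
    (hfp : IsStarProjection f) (hf0 : f ≠ 0) :
    ∃ g ∈ C, IsStarProjection g ∧ f * g = g ∧ ‖f Ω‖ ^ 2 / 3 ≤ ‖g Ω‖ ^ 2 ∧
      ‖g Ω‖ ^ 2 ≤ 2 * ‖f Ω‖ ^ 2 / 3 := by
  by_contra! hgap
  have hpos : ∀ g ∈ C, g ≠ 0 → 0 < ‖g Ω‖ ^ 2 := fun g hg hg0 => by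
    have : g Ω ≠ 0 := fun h => hg0 (hM.eq_zero_of_apply_eq_zero (hC.mem_of_mem hg) h)
    positivity
  set big : Set (H →L[ℂ] H) :=
    {g | g ∈ C ∧ IsStarProjection g ∧ f * g = g ∧ 2 * ‖f Ω‖ ^ 2 / 3 ≤ ‖g Ω‖ ^ 2} with hbig
  have hfbig : f ∈ big :=
    ⟨hf, hfp, hfp.isIdempotentElem.eq, by linarith [sq_nonneg ‖f Ω‖]⟩
  have hsub : (fun x : H →L[ℂ] H => x Ω) '' big ⊆ ballImage Ω (C : Set (H →L[ℂ] H)) :=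
    Set.image_mono fun g hg => ⟨hg.1, hg.2.1.norm_le⟩
  have hclosed : IsClosed ((fun x : H →L[ℂ] H => x Ω) '' big) := by
    refine isClosed_of_closure_subset fun η hη => ?_
    obtain ⟨u, hu, hlim⟩ := mem_closure_iff_seq_limit.mp hη
    choose x hx hxu using hu
    have hlim' : Tendsto (fun i => x i Ω) atTop (𝓝 η) := hlim.congr fun i => (hxu i).symm
    obtain ⟨a, ha, -, haη, hlima⟩ := hC.exists_of_tendsto hM (fun i => (hx i).1)
      (fun i => (hx i).2.1.norm_le) hlim'
    refine ⟨a, ⟨ha, .of_tendsto (Eventually.of_forall fun i => (hx i).2.1) hlima, ?_, ?_⟩, haη⟩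
    · ext1 ξ
      refine tendsto_nhds_unique ((f.continuous.tendsto _).comp (hlima ξ)) ?_
      refine (hlima ξ).congr fun i => ?_
      exact congrArg (fun z : H →L[ℂ] H => z ξ) (hx i).2.2.1.symm
    · exact ge_of_tendsto' ((hlima Ω).norm.pow 2) fun i => (hx i).2.2.2
  -- Take `g` of least trace among the subprojections with at least two thirds of the trace of `f`.
  -- A proper piece of `g` has smaller trace, hence less than two thirds, hence by the assumed gap
  -- less than one third. Two complementary pieces then cannot add up to `g`.
  obtain ⟨_, ⟨g, ⟨hg, hgp, hfg, hgbig⟩, rfl⟩, hgmin⟩ :=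
    (hK.of_isClosed_subset hclosed hsub).exists_isMinOn ⟨f Ω, f, hfbig, rfl⟩
      (f := fun η : H => ‖η‖ ^ 2) (by fun_prop)
  have hf1 := hpos f hf hf0
  have hg0 : g ≠ 0 := by
    rintro rfl
    simp only [zero_apply, norm_zero] at hgbig
    linarith
  obtain ⟨e, he, hep, hge, he0, heg⟩ := hC.exists_proper_subprojection hM hp hg hgp hg0 (hmin g)
  have hsplit := norm_apply_sq_eq_add_sub hep hge hgp Ω
  have hsmall : ∀ e ∈ C, IsStarProjection e → g * e = e → ‖e Ω‖ ^ 2 < ‖g Ω‖ ^ 2 →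
      ‖e Ω‖ ^ 2 < ‖f Ω‖ ^ 2 / 3 := by
    intro e he hep hge hlt
    by_contra! hthird
    have hfe : f * e = e := by rw [← hge, ← mul_assoc, hfg]
    have h1 := hgap e he hep hfe hthird
    have h2 := hgmin ⟨e, ⟨he, hep, hfe, h1.le⟩, rfl⟩
    simp only [Set.mem_ofPred_eq] at h2
    linarith
  have h1 := hpos e he he0
  have h2 := hpos (g - e) (sub_mem hg he) (sub_ne_zero.mpr heg.symm)
  have h3 := hsmall e he hep hge (by linarith)
  have h4 := hsmall (g - e) (sub_mem hg he) (hep.sub_of_mul_eq_right hgp hge)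
    (by rw [mul_sub, hgp.isIdempotentElem.eq, hge]) (by linarith)
  linarith

/-- Splitting off thirds repeatedly yields arbitrarily many uniformly separated projections. -/
theorem exists_separated_projections {C : NonUnitalStarSubalgebra ℂ (H →L[ℂ] H)}
    (hthird : ∀ f ∈ C, IsStarProjection f → f ≠ 0 →
      ∃ g ∈ C, IsStarProjection g ∧ f * g = g ∧ ‖f Ω‖ ^ 2 / 3 ≤ ‖g Ω‖ ^ 2 ∧
        ‖g Ω‖ ^ 2 ≤ 2 * ‖f Ω‖ ^ 2 / 3)
    (hpos : ∀ g ∈ C, g ≠ 0 → 0 < ‖g Ω‖ ^ 2) (n : ℕ) :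
    ∀ f ∈ C, IsStarProjection f → f ≠ 0 → ∃ g : Fin n → H →L[ℂ] H,
      (∀ i, g i ∈ C ∧ IsStarProjection (g i) ∧ f * g i = g i ∧ ‖f Ω‖ ^ 2 / 3 ≤ ‖g i Ω‖ ^ 2 ∧
        ‖g i Ω‖ ^ 2 ≤ 2 * ‖f Ω‖ ^ 2 / 3) ∧
      ∀ i j, i ≠ j → ‖f Ω‖ ^ 2 / 3 ≤ ‖(g i - g j) Ω‖ ^ 2 := by
  induction n with
  | zero => exact fun f _ _ _ => ⟨Fin.elim0, fun i => i.elim0, fun i => i.elim0⟩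
  | succ n ih =>
    intro f hf hfp hf0
    have hf1 := hpos f hf hf0
    obtain ⟨h, hh, hhp, hfh, hh1, hh2⟩ := hthird f hf hfp hf0
    have hsplit := norm_apply_sq_eq_add_sub hhp hfh hfp Ω
    set k := f - h with hk
    have hkC : k ∈ C := sub_mem hf hh
    have hkp : IsStarProjection k := hhp.sub_of_mul_eq_right hfp hfh
    have hfk : f * k = k := by rw [hk, mul_sub, hfp.isIdempotentElem.eq, hfh]
    have hhk : h * k = 0 := by
      rw [hk, mul_sub, hhp.mul_eq_right_comm hfp hfh, hhp.isIdempotentElem.eq, sub_self]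
    have hh0 : h ≠ 0 := by
      rintro rfl
      simp only [zero_apply, norm_zero] at hh1
      linarith
    have hk0 : k ≠ 0 := by
      intro h0
      rw [h0, zero_apply, norm_zero] at hsplit
      linarith
    obtain ⟨u, hu, husep⟩ := ih h hh hhp hh0
    obtain ⟨v, hv, hvsep⟩ := ih k hkC hkp hk0
    have huv : ∀ x y, h * x = x → k * y = y → star x * y = 0 := fun x y hx hy => by
      rw [← hx, ← hy, star_mul, hhp.isSelfAdjoint.star_eq, mul_assoc, ← mul_assoc h, hhk, zero_mul,
        mul_zero]
    have hnorm : ∀ x y, h * x = x → k * y = y → ‖(x + y) Ω‖ ^ 2 = ‖x Ω‖ ^ 2 + ‖y Ω‖ ^ 2 :=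
      fun x y hx hy => norm_add_apply_sq (huv x y hx hy) Ω
    have hfirst : ∀ i, ‖f Ω‖ ^ 2 / 3 ≤ ‖(h - (u i + v i)) Ω‖ ^ 2 := by
      intro i
      obtain ⟨-, hup, hhu, -, hu2⟩ := hu i
      obtain ⟨-, -, hkv, hv1, -⟩ := hv i
      have e1 := norm_apply_sq_eq_add_sub hup hhu hhp Ω
      have e2 : h - (u i + v i) = (h - u i) + -v i := by abel
      rw [e2, hnorm _ _ (by rw [mul_sub, hhp.isIdempotentElem.eq, hhu]) (by rw [mul_neg, hkv]),
        neg_apply, norm_neg]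
      linarith
    -- Recursing in both orthogonal halves `h` and `k` keeps the separation constant: the squared
    -- distances in the halves add, giving at least a third of the trace of `h` plus a third of that
    -- of `k`. For `h` against `u i + v i` the two parts are `h - u i` and `v i`.
    refine ⟨Fin.cons h fun i => u i + v i, fun i => ?_, fun i j hij => ?_⟩
    · refine Fin.cases ?_ (fun i => ?_) i
      · exact ⟨hh, hhp, hfh, hh1, hh2⟩
      · obtain ⟨huC, hup, hhu, hu1, hu2⟩ := hu i
        obtain ⟨hvC, hvp, hkv, hv1, hv2⟩ := hv i
        simp only [Fin.cons_succ]
        refine ⟨add_mem huC hvC, hup.add hvp ?_, ?_, ?_, ?_⟩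
        · rw [← hup.isSelfAdjoint.star_eq]
          exact huv _ _ hhu hkv
        · rw [mul_add, ← hhu, ← hkv, ← mul_assoc, ← mul_assoc, hfh, hfk]
        · rw [hnorm _ _ hhu hkv]; linarith
        · rw [hnorm _ _ hhu hkv]; linarith
    · revert hij
      refine Fin.cases ?_ (fun i => ?_) i <;> refine Fin.cases ?_ (fun j => ?_) j
      · exact fun hij => absurd rfl hij
      · exact fun _ => by simpa only [Fin.cons_succ, Fin.cons_zero] using hfirst j
      · intro _
        simp only [Fin.cons_succ, Fin.cons_zero]
        rw [← neg_sub, neg_apply, norm_neg]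
        exact hfirst i
      · intro hij
        have hij' : i ≠ j := fun h => hij (by rw [h])
        simp only [Fin.cons_succ]
        rw [add_sub_add_comm, hnorm _ _ (by rw [mul_sub, (hu i).2.2.1, (hu j).2.2.1])
          (by rw [mul_sub, (hv i).2.2.1, (hv j).2.2.1])]
        linarith [husep i j hij', hvsep i j hij']

/-- Pigeonhole: among more projections than balls of radius `‖p Ω‖ / 4` in a cover, two lie at
squared distance at most `‖p Ω‖ ^ 2 / 4`, against the separation `‖p Ω‖ ^ 2 / 3`. -/
theorem exists_isMinimalProjection_of_totallyBounded (hM : IsSaturatedTracial M Ω)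
    (hC : IsCornerCommutant M D p C) (hpC : p ∈ C) (hp : IsStarProjection p) (hp0 : p ≠ 0)
    (hK : TotallyBounded (ballImage Ω (C : Set (H →L[ℂ] H)))) :
    ∃ e, IsMinimalProjection C e := by
  by_contra! hmin
  have hpos : ∀ g ∈ C, g ≠ 0 → 0 < ‖g Ω‖ ^ 2 := fun g hg hg0 => by
    have : g Ω ≠ 0 := fun h => hg0 (hM.eq_zero_of_apply_eq_zero (hC.mem_of_mem hg) h)
    positivity
  have hKc : IsCompact (ballImage Ω (C : Set (H →L[ℂ] H))) :=
    isCompact_iff_totallyBounded_isComplete.mpr ⟨hK, (hC.isClosed_ballImage hM).isComplete⟩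
  have hp1 : 0 < ‖p Ω‖ := by
    have := hpos p hpC hp0
    exact norm_pos_iff.mpr fun h => by simp [h] at this
  obtain ⟨t, ht, hcover⟩ := Metric.totallyBounded_iff.mp hK (‖p Ω‖ / 4) (by positivity)
  obtain ⟨g, hg, hgsep⟩ := exists_separated_projections (Ω := Ω)
    (fun f hf hfp hf0 => hC.exists_subprojection_thirds hM hp.isSelfAdjoint hKc hmin hf hfp hf0)
    hpos (ht.toFinset.card + 1) p hpC hp hp0
  have hball : ∀ i, ∃ y ∈ t, g i Ω ∈ Metric.ball y (‖p Ω‖ / 4) := fun i => by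
    simpa using hcover ⟨g i, ⟨(hg i).1, (hg i).2.1.norm_le⟩, rfl⟩
  choose y hyt hy using hball
  obtain ⟨i, -, j, -, hij, hyij⟩ := Finset.exists_ne_map_eq_of_card_lt_of_maps_to
    (s := Finset.univ) (t := ht.toFinset) (f := y) (by simp) (fun i _ => by simpa using hyt i)
  have h1 := hgsep i j hij
  have h2 := hy i
  have h3 := hy j
  rw [hyij] at h2
  rw [Metric.mem_ball] at h2 h3
  have h4 := dist_triangle_right (g i Ω) (g j Ω) (y j)
  rw [dist_eq_norm (g i Ω), ← sub_apply] at h4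
  have h5 : ‖(g i - g j) Ω‖ ≤ ‖p Ω‖ / 2 := by linarith
  have h6 := pow_le_pow_left₀ (norm_nonneg _) h5 2
  nlinarith [sq_pos_of_pos hp1]

/-- A nonzero separable corner of the relative commutant of a separable set has a minimal
projection. -/
theorem exists_isMinimalProjection (hM : IsSaturatedTracial M Ω) (hC : IsCornerCommutant M D p C)
    (hDM : ∀ d ∈ D, d ∈ M) (hDne : D.Nonempty) (hD : IsSeparableTwo Ω D) (hpC : p ∈ C)
    (hp : IsStarProjection p) (hp0 : p ≠ 0) (hCs : IsSeparableTwo Ω (C : Set (H →L[ℂ] H))) :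
    ∃ e, IsMinimalProjection C e :=
  hC.exists_isMinimalProjection_of_totallyBounded hM hpC hp hp0
    (hC.totallyBounded_ballImage hM hDM hDne hD (hC.mem_of_mem hpC) hCs)

end IsCornerCommutant

end Compactness

/-! ### Sums of orthogonal projections and the atomic part. -/

section AtomicDecomposition

variable {H : Type*} [NormedAddCommGroup H] [InnerProductSpace ℂ H] [CompleteSpace H]

section OrthogonalProjections

variable {S : Set (H →L[ℂ] H)}

omit [CompleteSpace H] in
theorem mul_sum_eq_zero_of_pairwise (horth : S.Pairwise fun e f => e * f = 0) {e : S}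
    {T : Finset S} (he : e ∉ T) : (e : H →L[ℂ] H) * ∑ f ∈ T, (f : H →L[ℂ] H) = 0 := by
  rw [Finset.mul_sum]
  refine Finset.sum_eq_zero fun f hf => horth e.2 f.2 fun h => he ?_
  rwa [Subtype.ext h]

theorem isStarProjection_sum (hS : ∀ e ∈ S, IsStarProjection e)
    (horth : S.Pairwise fun e f => e * f = 0) (T : Finset S) :
    IsStarProjection (∑ f ∈ T, (f : H →L[ℂ] H)) := by
  classical
  induction T using Finset.induction_on with
  | empty => simp
  | insert e T he ih =>
    rw [Finset.sum_insert he]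
    exact (hS e e.2).add ih (mul_sum_eq_zero_of_pairwise horth he)

theorem norm_sum_apply_sq (hS : ∀ e ∈ S, IsStarProjection e)
    (horth : S.Pairwise fun e f => e * f = 0) (T : Finset S) (ξ : H) :
    ‖(∑ f ∈ T, (f : H →L[ℂ] H)) ξ‖ ^ 2 = ∑ f ∈ T, ‖(f : H →L[ℂ] H) ξ‖ ^ 2 := by
  classical
  induction T using Finset.induction_on with
  | empty => simp
  | insert e T he ih =>
    rw [Finset.sum_insert he, Finset.sum_insert he, ← ih]
    refine norm_add_apply_sq ?_ ξ
    rw [(hS e e.2).isSelfAdjoint.star_eq]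
    exact mul_sum_eq_zero_of_pairwise horth he

/-- Bessel's inequality: the ranges are orthogonal, and finite partial sums are projections, so
their squared norms at `ξ` stay below `‖ξ‖ ^ 2`. -/
theorem summable_apply_of_pairwise (hS : ∀ e ∈ S, IsStarProjection e)
    (horth : S.Pairwise fun e f => e * f = 0) (ξ : H) :
    Summable fun e : S => (e : H →L[ℂ] H) ξ := by
  have hfam : OrthogonalFamily ℂ (fun e : S => ((e : H →L[ℂ] H) : H →ₗ[ℂ] H).range)
      fun e => ((e : H →L[ℂ] H) : H →ₗ[ℂ] H).range.subtypeₗᵢ := by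
    rintro e f hef ⟨_, v, rfl⟩ ⟨_, w, rfl⟩
    simp only [Submodule.coe_subtypeₗᵢ, Submodule.subtype_apply, ContinuousLinearMap.coe_coe]
    rw [← ContinuousLinearMap.adjoint_inner_right, ← ContinuousLinearMap.star_eq_adjoint,
      (hS e e.2).isSelfAdjoint.star_eq, ← mul_apply_eq_comp,
      horth e.2 f.2 fun h => hef (Subtype.ext h)]
    simp
  refine (hfam.summable_iff_norm_sq_summable fun e : S => ⟨(e : H →L[ℂ] H) ξ, ξ, rfl⟩).mpr ?_
  refine summable_of_sum_le (c := ‖ξ‖ ^ 2) (fun _ => by positivity) fun T => ?_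
  have h1 := (norm_sum_apply_sq hS horth T ξ).symm
  refine le_of_eq_of_le h1 ?_
  have h2 := (∑ f ∈ T, (f : H →L[ℂ] H)).le_of_opNorm_le (isStarProjection_sum hS horth T).norm_le ξ
  rw [one_mul] at h2
  gcongr

end OrthogonalProjections

namespace IsCornerCommutant

variable {M : StarSubalgebra ℂ (H →L[ℂ] H)} {Ω : H} {D : Set (H →L[ℂ] H)} {p : H →L[ℂ] H}
  {C : NonUnitalStarSubalgebra ℂ (H →L[ℂ] H)}

/-- Sums of orthogonal projections of `C` exist in `C`. -/
theorem exists_hasSum (hM : IsSaturatedTracial M Ω) (hC : IsCornerCommutant M D p C)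
    {S : Set (H →L[ℂ] H)} (hSC : ∀ e ∈ S, e ∈ C) (hS : ∀ e ∈ S, IsStarProjection e)
    (horth : S.Pairwise fun e f => e * f = 0) :
    ∃ q ∈ C, IsStarProjection q ∧ (∀ ξ : H, HasSum (fun e : S => (e : H →L[ℂ] H) ξ) (q ξ)) ∧
      ∀ e ∈ S, e * q = e := by
  obtain ⟨η, hη⟩ := summable_apply_of_pairwise hS horth Ω
  have hsum : ∀ (T : Finset S) (ξ : H), (∑ e ∈ T, (e : H →L[ℂ] H)) ξ =
      ∑ e ∈ T, (e : H →L[ℂ] H) ξ := fun T ξ => sum_apply T _ ξ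
  obtain ⟨q, hq, -, -, hlim⟩ := hC.exists_of_tendsto hM (l := atTop)
    (x := fun T : Finset S => ∑ e ∈ T, (e : H →L[ℂ] H)) (η := η)
    (fun T => sum_mem fun e _ => hSC e e.2) (fun T => (isStarProjection_sum hS horth T).norm_le)
    (by simp only [hsum]; simpa [HasSum] using hη)
  have hqs : ∀ ξ : H, HasSum (fun e : S => (e : H →L[ℂ] H) ξ) (q ξ) := fun ξ => by
    have := hlim ξ
    simp only [hsum] at this
    simpa [HasSum] using this
  refine ⟨q, hq, .of_tendsto (Eventually.of_forall (isStarProjection_sum hS horth)) hlim, hqs, ?_⟩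
  intro e he
  ext1 ξ
  refine ((hqs ξ).mapL e).unique ?_
  have h1 := hasSum_single (f := fun f : S => e ((f : H →L[ℂ] H) ξ)) ⟨e, he⟩ fun f hf => by
    rw [← mul_apply_eq_comp, horth he f.2 fun h => hf (Subtype.ext h.symm), zero_apply]
  simpa only [← mul_apply_eq_comp, (hS e he).isIdempotentElem.eq] using h1

end IsCornerCommutant

/-- A nonzero element `x = x e`, `e` a minimal projection, has a minimal left support. -/
theorem IsMinimalProjection.exists_left {B : NonUnitalStarSubalgebra ℂ (H →L[ℂ] H)}
    {e x : H →L[ℂ] H} (he : IsMinimalProjection B e) (hx : x ∈ B) (hxe : x * e = x) (hx0 : x ≠ 0) :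
    ∃ c : ℂ, IsMinimalProjection B (c • (x * star x)) := by
  have hes := he.proj.isSelfAdjoint.star_eq
  have hex : e * star x = star x := by
    have := congrArg star hxe
    rwa [star_mul, hes] at this
  -- Since `x = x * e`, these elements lie in `e B e`. In particular `star x * x = c • e`, so `c⁻¹ •
  -- (x * star x)` is the left support projection of `x`.
  have hcorner : ∀ y ∈ B, ∃ c : ℂ, star x * y * x = c • e := fun y hy => by
    obtain ⟨c, hc⟩ := he.minimal (star x * y * x) (mul_mem (mul_mem (star_mem hx) hy) hx)
    refine ⟨c, ?_⟩
    have : e * (star x * y * x) * e = e * star x * y * (x * e) := by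
      simp only [mul_assoc]
    rw [← hc, this, hex, hxe]
  obtain ⟨c, hc⟩ := he.minimal (star x * x) (mul_mem (star_mem hx) hx)
  rw [mul_assoc, mul_assoc (star x), hxe, ← mul_assoc, hex] at hc
  have hxx : star x * x ≠ 0 := fun h => hx0 (CStarRing.star_mul_self_eq_zero_iff x |>.mp h)
  have hc0 : c ≠ 0 := by
    rintro rfl
    exact hxx (by rw [hc, zero_smul])
  have hcs : star c = c := by
    have h1 := congrArg star hc
    rw [star_mul, star_star, star_smul, hes, hc] at h1
    exact (smul_left_injective ℂ he.ne_zero h1).symm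
  have hxcx : x * star x * (x * star x) = c • (x * star x) := by
    rw [mul_assoc, ← mul_assoc (star x), hc, smul_mul_assoc, mul_smul_comm, hex]
  refine ⟨c⁻¹, SMulMemClass.smul_mem _ (mul_mem hx (star_mem hx)), ⟨?_, ?_⟩, ?_, fun y hy => ?_⟩
  · rw [IsIdempotentElem, smul_mul_assoc, mul_smul_comm, hxcx, smul_smul, smul_smul,
      inv_mul_cancel_right₀ hc0]
  · rw [IsSelfAdjoint, star_smul, star_mul, star_star, star_inv₀, hcs]
  · refine smul_ne_zero (inv_ne_zero hc0) fun h => hx0 ?_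
    exact CStarRing.mul_star_self_eq_zero_iff x |>.mp h
  · obtain ⟨d, hd⟩ := hcorner y hy
    refine ⟨c⁻¹ * d, ?_⟩
    have h1 : x * star x * y * (x * star x) = d • (x * star x) := by
      have : x * star x * y * (x * star x) = x * (star x * y * x) * star x := by
        simp only [mul_assoc]
      rw [this, hd, mul_smul_comm, hxe, smul_mul_assoc]
    rw [smul_mul_assoc, smul_mul_assoc, mul_smul_comm, h1]
    simp only [smul_smul]
    congr 1
    ring

/-- The central cut-down of an algebra to its atomic part. -/
theorem IsCornerCommutant.exists_atomic_part {M : StarSubalgebra ℂ (H →L[ℂ] H)} {Ω : H}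
    {D : Set (H →L[ℂ] H)} {B : NonUnitalStarSubalgebra ℂ (H →L[ℂ] H)}
    (hM : IsSaturatedTracial M Ω) (hB : IsCornerCommutant M D 1 B) (h1B : 1 ∈ B) :
    ∃ (q : H →L[ℂ] H) (hq : IsCentralProjection B q) (hq' : IsCentralProjection B (1 - q)),
      IsAtomicAlgebra (directSummand B hq) ∧ IsDiffuseAlgebra (directSummand B hq') := by
  obtain ⟨S, ⟨hSmin, horth⟩, hmax⟩ := zorn_subset
    {S : Set (H →L[ℂ] H) | (∀ e ∈ S, IsMinimalProjection B e) ∧ S.Pairwise fun e f => e * f = 0}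
    fun c hc hchain => ⟨⋃₀ c, ⟨fun e ⟨s, hs, he⟩ => (hc hs).1 e he,
      (Set.pairwise_sUnion hchain.directedOn).mpr fun s hs => (hc hs).2⟩,
      fun s hs => Set.subset_sUnion_of_mem hs⟩
  have hnone : ∀ f, IsMinimalProjection B f → ∃ e ∈ S, f * e ≠ 0 := by
    intro f hf
    by_contra! hcon
    have hfS : f ∈ S := by
      refine hmax (y := insert f S) ⟨?_, ?_⟩ (Set.subset_insert f S) (Set.mem_insert f S)
      · rintro e (rfl | he)
        · exact hf
        · exact hSmin e he
      · refine horth.insert fun e he _ => ⟨hcon e he, ?_⟩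
        have := congrArg star (hcon e he)
        rwa [star_mul, hf.proj.isSelfAdjoint.star_eq, (hSmin e he).proj.isSelfAdjoint.star_eq,
          star_zero] at this
    exact hf.ne_zero (by rw [← hf.proj.isIdempotentElem.eq]; exact hcon f hfS)
  obtain ⟨q, hqB, hqp, hqsum, hSq⟩ := hB.exists_hasSum hM (fun e he => (hSmin e he).mem)
    (fun e he => (hSmin e he).proj) horth
  have hqS : ∀ e ∈ S, q * e = e := fun e he => by
    have := congrArg star (hSq e he)
    rwa [star_mul, hqp.isSelfAdjoint.star_eq, (hSmin e he).proj.isSelfAdjoint.star_eq] at this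
  have h1qB : 1 - q ∈ B := sub_mem h1B hqB
  have hS1q : ∀ e ∈ S, (1 - q) * e = 0 := fun e he => by rw [sub_mul, one_mul, hqS e he, sub_self]
  -- Otherwise the left support of `(1 - q) * b * e` is a minimal projection below `1 - q`,
  -- orthogonal to all of `S`, against maximality.
  have hinv : ∀ b ∈ B, ∀ e ∈ S, q * b * e = b * e := by
    intro b hb e he
    by_contra hne
    have hx0 : (1 - q) * b * e ≠ 0 := fun h => hne (by
      rw [sub_mul, sub_mul, one_mul, sub_eq_zero] at h
      exact h.symm)
    obtain ⟨c, hc⟩ := (hSmin e he).exists_left (x := (1 - q) * b * e)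
      (mul_mem (mul_mem h1qB hb) (hSmin e he).mem)
      (by rw [mul_assoc, (hSmin e he).proj.isIdempotentElem.eq]) hx0
    obtain ⟨e', he', hne'⟩ := hnone _ hc
    refine hne' ?_
    have h2 : star ((1 - q) * b * e) * e' = 0 := by
      rw [star_mul, star_mul, hqp.one_sub.isSelfAdjoint.star_eq, mul_assoc, mul_assoc, hS1q e' he',
        mul_zero, mul_zero]
    rw [smul_mul_assoc, mul_assoc, h2, mul_zero, smul_zero]
  -- Summing over `S` makes the range of `q` invariant under `B`; applied to adjoints as well, this
  -- gives centrality.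
  have hqbq : ∀ b ∈ B, q * b * q = b * q := by
    intro b hb
    ext1 ξ
    refine ((hqsum ξ).mapL (q * b)).unique (((hqsum ξ).mapL b).congr_fun fun e => ?_)
    exact congrArg (fun z : H →L[ℂ] H => z ξ) (hinv b hb e e.2)
  have hcomm : ∀ b ∈ B, b * q = q * b := by
    intro b hb
    have := congrArg star (hqbq (star b) (star_mem hb))
    simp only [star_mul, star_star, hqp.isSelfAdjoint.star_eq] at this
    rw [← this, ← mul_assoc, hqbq b hb]
  have hq : IsCentralProjection B q := ⟨hqB, hqp, hcomm⟩
  have hq' : IsCentralProjection B (1 - q) :=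
    ⟨h1qB, hqp.one_sub, fun b hb => by rw [mul_sub, sub_mul, mul_one, one_mul, hcomm b hb]⟩
  refine ⟨q, hq, hq', ⟨q, ⟨hqB, hqp.isIdempotentElem.eq⟩, ?_, S, ?_, horth, hqsum⟩, ?_⟩
  · rintro x ⟨hx, hxq⟩
    exact ⟨by rw [← hcomm x hx, hxq], hxq⟩
  · intro e he
    have h := hSmin e he
    exact ⟨⟨h.mem, hSq e he⟩, h.proj, h.ne_zero, fun x hx => h.minimal x hx.1⟩
  · intro f hf
    have hfq : f * (1 - q) = f := hf.mem.2
    have hfq' : (1 - q) * f = f := by rw [← hq'.comm f hf.mem.1, hfq]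
    have hfB : IsMinimalProjection B f := by
      refine ⟨hf.mem.1, hf.proj, hf.ne_zero, fun x hx => ?_⟩
      obtain ⟨c, hc⟩ := hf.minimal (x * (1 - q)) ((mem_directSummand_iff hq').mpr ⟨x, hx, rfl⟩)
      refine ⟨c, ?_⟩
      rw [← hc, mul_assoc, mul_assoc, mul_assoc, hfq']
    obtain ⟨e, he, hne⟩ := hnone f hfB
    exact hne (by rw [← hfq, mul_assoc, hS1q e he, mul_zero])

end AtomicDecomposition

/-! ### Non-separability of summands and of maximal abelian subalgebras. -/

section RelativeCommutant

variable {H : Type*} [NormedAddCommGroup H] [InnerProductSpace ℂ H] [CompleteSpace H]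
  {M : StarSubalgebra ℂ (H →L[ℂ] H)} {Ω : H} {P : VonNeumannAlgebra H}

theorem isCornerCommutant_relCommutant :
    IsCornerCommutant M (P : Set (H →L[ℂ] H)) 1 (relCommutant P M) := fun x => by
  rw [mem_relCommutant_iff]
  simp

/-- In a diffuse direct summand of the relative commutant of a separable algebra, no nonzero
direct summand is separable. -/
theorem hasNoSeparableSummand_of_isDiffuse (hM : IsSaturatedTracial M Ω)
    (hPM : ∀ x ∈ P, x ∈ M) (hP : IsSeparableTwo Ω (P : Set (H →L[ℂ] H))) {z : H →L[ℂ] H}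
    (hz : IsCentralProjection (relCommutant P M) z)
    (hdiff : IsDiffuseAlgebra (directSummand (relCommutant P M) hz)) :
    HasNoSeparableSummand Ω (directSummand (relCommutant P M) hz) := by
  intro p hp hp0 hsep
  have hC : IsCornerCommutant M (P : Set (H →L[ℂ] H)) p (directSummand _ hp) := by
    intro x
    constructor
    · rintro ⟨hx, hxp⟩
      obtain ⟨h1, h2⟩ := mem_relCommutant_iff.mp hx.1
      exact ⟨h1, h2, by rw [← hp.comm x hx, hxp], hxp⟩
    · rintro ⟨h1, h2, -, h4⟩
      refine ⟨⟨mem_relCommutant_iff.mpr ⟨h1, h2⟩, ?_⟩, h4⟩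
      rw [← h4, mul_assoc, hp.mem.2]
  obtain ⟨e, he⟩ := hC.exists_isMinimalProjection hM hPM ⟨1, one_mem P⟩ hP
    ⟨hp.mem, hp.proj.isIdempotentElem.eq⟩ hp.proj hp0 hsep
  -- Minimality passes up from the summand because `e * (x * p) * e = e * x * e` for `e` below `p`.
  refine hdiff e ⟨he.mem.1, he.proj, he.ne_zero, fun x hx => ?_⟩
  obtain ⟨c, hc⟩ := he.minimal (x * p) ((mem_directSummand_iff hp).mpr ⟨x, hx, rfl⟩)
  refine ⟨c, ?_⟩
  rw [← hc, mul_assoc, mul_assoc, mul_assoc, ← hp.comm e he.mem.1, he.mem.2]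

omit [CompleteSpace H] in
theorem IsSeparableTwo.union {B₁ B₂ : Set (H →L[ℂ] H)} (h₁ : IsSeparableTwo Ω B₁)
    (h₂ : IsSeparableTwo Ω B₂) : IsSeparableTwo Ω (B₁ ∪ B₂) := by
  rw [IsSeparableTwo, Set.image_union]
  exact TopologicalSpace.IsSeparable.union h₁ h₂

/-- In a diffuse direct summand of the relative commutant of a separable algebra, no nonzero
direct summand of a maximal abelian subalgebra is separable. -/
theorem IsMASA.hasNoSeparableSummand (hM : IsSaturatedTracial M Ω)
    (hPM : ∀ x ∈ P, x ∈ M) (hP : IsSeparableTwo Ω (P : Set (H →L[ℂ] H))) {z : H →L[ℂ] H}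
    (hz : IsCentralProjection (relCommutant P M) z)
    (hdiff : IsDiffuseAlgebra (directSummand (relCommutant P M) hz))
    {A : NonUnitalStarSubalgebra ℂ (H →L[ℂ] H)}
    (hA : IsMASA A (directSummand (relCommutant P M) hz)) : HasNoSeparableSummand Ω A := by
  intro p hp hp0 hsep
  have hAM : ∀ x ∈ A, x ∈ M ∧ ∀ y ∈ P, y * x = x * y := fun x hx =>
    mem_relCommutant_iff.mp (hA.le hx).1
  -- Adjoining `A p` to `P` makes `A p` its own corner commutant: an `x` under `p` commuting with `A
  -- p` commutes with `A`, so maximality applies. The enlarged set is still separable.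
  have hC : IsCornerCommutant M ((P : Set (H →L[ℂ] H)) ∪ (directSummand A hp : Set (H →L[ℂ] H)))
      p (directSummand A hp) := by
    intro x
    constructor
    · rintro ⟨hx, hxp⟩
      refine ⟨(hAM x hx).1, ?_, by rw [← hp.comm x hx, hxp], hxp⟩
      rintro d (hd | hd)
      · exact (hAM x hx).2 d hd
      · exact hA.comm d hd.1 x hx
    · rintro ⟨h1, h2, h3, h4⟩
      have hxB : x ∈ directSummand (relCommutant P M) hz := by
        refine ⟨mem_relCommutant_iff.mpr ⟨h1, fun y hy => h2 y (Or.inl hy)⟩, ?_⟩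
        rw [← h4, mul_assoc, (hA.le hp.mem).2]
      refine ⟨hA.maximal x hxB fun a ha => ?_, h4⟩
      have h5 := h2 (a * p) (Or.inr ((mem_directSummand_iff hp).mpr ⟨a, ha, rfl⟩))
      rw [mul_assoc, h3, hp.comm a ha, ← mul_assoc, h4] at h5
      exact h5
  obtain ⟨e, he⟩ := hC.exists_isMinimalProjection hM
    (by
      rintro d (hd | hd)
      · exact hPM d hd
      · exact (hAM d hd.1).1)
    ⟨1, Or.inl (one_mem P)⟩ (hP.union hsep) ⟨hp.mem, hp.proj.isIdempotentElem.eq⟩ hp.proj hp0 hsep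
  have heA : e ∈ A := he.mem.1
  have hee := he.proj.isIdempotentElem.eq
  have hscal : ∀ a ∈ A, ∃ c : ℂ, a * e = c • e ∧ e * a = c • e := by
    intro a ha
    obtain ⟨c, hc⟩ := he.minimal (a * p) ((mem_directSummand_iff hp).mpr ⟨a, ha, rfl⟩)
    have h1 : e * a = c • e := by
      rw [← hc, mul_assoc, mul_assoc, ← hp.comm e heA, he.mem.2, hA.comm a ha e heA, ← mul_assoc,
        hee]
    exact ⟨c, by rw [hA.comm a ha e heA, h1], h1⟩
  refine hdiff e ⟨hA.le heA, he.proj, he.ne_zero, fun x hx => ?_⟩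
  -- Each element of `A` acts on `e` as a scalar, so it commutes with `e * x * e`; maximality puts
  -- this element in `A`, where it is a multiple of `e`.
  have hexe : e * x * e ∈ A := by
    refine hA.maximal _ (mul_mem (mul_mem (hA.le heA) hx) (hA.le heA)) fun a ha => ?_
    obtain ⟨c, hc1, hc2⟩ := hscal a ha
    rw [mul_assoc _ e a, hc2, ← mul_assoc, ← mul_assoc, hc1, smul_mul_assoc, smul_mul_assoc,
      mul_smul_comm]
  obtain ⟨c, hc, -⟩ := hscal _ hexe
  exact ⟨c, by rw [← hc, mul_assoc _ e e, hee]⟩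

end RelativeCommutant

/-! ### Contractive lifts, diagonal sequences and saturation of the ultraproduct. -/

section UltraproductSaturated

theorem StarAlgHom.continuous_of_cstar {A B : Type*} [CStarAlgebra A] [CStarAlgebra B]
    (φ : A →⋆ₐ[ℂ] B) : Continuous φ :=
  AddMonoidHomClass.continuous_of_bound φ 1 fun x => by
    rw [one_mul]
    exact NonUnitalStarAlgHom.norm_apply_le φ x

/-- Averaging with the adjoint gives a self-adjoint lift with the same image, and functional
calculus commutes with `φ`. -/
theorem StarAlgHom.exists_apply_eq_posPart {A B : Type*} [CStarAlgebra A] [CStarAlgebra B]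
    (φ : A →⋆ₐ[ℂ] B) (x : A) (hs : IsSelfAdjoint (φ x)) : ∃ y, φ y = (φ x)⁺ := by
  set y : A := (1 / 2 : ℂ) • (x + star x) with hy
  have hys : IsSelfAdjoint y := by
    rw [hy, IsSelfAdjoint, star_smul, star_add, star_star, add_comm]
    simp
  have hyx : φ y = φ x := by
    rw [hy, map_smul, map_add, map_star, hs.star_eq, ← two_smul ℂ, smul_smul]
    norm_num
  refine ⟨y⁺, ?_⟩
  rw [← hyx, CFC.posPart_def, CFC.posPart_def]
  exact NonUnitalStarAlgHomClass.map_cfcₙ (S := ℂ) φ _ y (hφ := φ.continuous_of_cstar)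
    (hφa := hys.map φ)

/-- The contraction obtained from `y` by cutting off the modulus at `1`. -/
theorem exists_norm_le_one_lift {A B : Type*} [CStarAlgebra A] [CStarAlgebra B] (φ : A →⋆ₐ[ℂ] B)
    (y : A) (hy : ‖φ y‖ ≤ 1) : ∃ y' : A, ‖y'‖ ≤ 1 ∧ φ y' = φ y := by
  rcases subsingleton_or_nontrivial B with hB | hB
  · exact ⟨0, by simp, Subsingleton.elim _ _⟩
  let _ : PartialOrder A := CStarAlgebra.spectralOrder A
  let _ : StarOrderedRing A := CStarAlgebra.spectralOrderedRing A
  -- Here `g t * t * g t = t / max 1 t ≤ 1` for `t ≥ 0` bounds the new lift, while `g = 1` on the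
  -- spectrum of `star (φ y) * φ y`, so the image is unchanged.
  set g : ℝ → ℝ := fun t => (√(max 1 t))⁻¹ with hg
  have hgc : Continuous g := by
    refine (Real.continuous_sqrt.comp (continuous_const.max continuous_id)).inv₀ fun t => ?_
    exact (Real.sqrt_pos.mpr (lt_max_of_lt_left one_pos)).ne'
  have hz : IsSelfAdjoint (star y * y) := .star_mul_self y
  have hz0 : 0 ≤ star y * y := star_mul_self_nonneg y
  refine ⟨y * cfc g (star y * y), ?_, ?_⟩
  · have h1 : star (y * cfc g (star y * y)) * (y * cfc g (star y * y)) =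
        cfc (fun t => g t * t * g t) (star y * y) := by
      rw [cfc_mul (fun t => g t * t) g (star y * y) (by fun_prop) (by fun_prop),
        cfc_mul g (fun t => t) (star y * y) (by fun_prop) (by fun_prop), cfc_id' ℝ (star y * y),
        star_mul, (cfc_predicate g (star y * y)).star_eq]
      simp only [mul_assoc]
    have h2 : ‖cfc (fun t => g t * t * g t) (star y * y)‖ ≤ 1 := by
      refine norm_cfc_le zero_le_one fun t ht => ?_
      have ht0 : 0 ≤ t := spectrum_nonneg_of_nonneg hz0 ht
      have hm : (1 : ℝ) ≤ max 1 t := le_max_left _ _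
      have h3 : g t * t * g t = t / max 1 t := by
        rw [hg]
        simp only
        rw [mul_right_comm, ← mul_inv, Real.mul_self_sqrt (by positivity), div_eq_inv_mul]
      rw [h3, Real.norm_of_nonneg (by positivity)]
      exact div_le_one_of_le₀ (le_max_right _ _) (by positivity)
    rw [← h1, CStarRing.norm_star_mul_self] at h2
    nlinarith [norm_nonneg (y * cfc g (star y * y))]
  · have hone : cfc g (star (φ y) * φ y) = 1 := by
      rw [← cfc_one ℝ (star (φ y) * φ y) (ha := .star_mul_self _)]
      refine cfc_congr fun t ht => ?_
      have h1 : ‖t‖ ≤ 1 := by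
        refine (spectrum.norm_le_norm_of_mem ht).trans ?_
        rw [CStarRing.norm_star_mul_self]
        exact mul_le_one₀ hy (norm_nonneg _) hy
      have h2 : max 1 t = 1 := max_eq_left ((le_abs_self t).trans h1)
      simp [hg, h2]
    rw [map_mul, StarAlgHom.map_cfc φ g (star y * y) (hφ := φ.continuous_of_cstar) (hφa := by
      rw [map_mul, map_star]; exact .star_mul_self _), map_mul, map_star, hone, mul_one]

variable {M : ℕ → Type*} [∀ n, CStarAlgebra (M n)] [∀ n, Nontrivial (M n)]
  (τ : ∀ n, TracialState (M n)) (ω : Ultrafilter ℕ)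

/-- The norm `‖x‖₂` of an element of the ultraproduct is the limit of the norms of the terms. -/
theorem tendsto_sqrt_trace (x : BddSeq M) :
    Tendsto (fun n => √(τ n (star (x n) * x n)).re) ω (𝓝 ‖ultraClass τ ω x (traceVec τ ω)‖) := by
  have h1 := (Complex.continuous_re.tendsto _).comp (tendsto_limTrace' τ ω (star x * x))
  rw [← norm_traceVec_sq, Complex.ofReal_re] at h1
  have h2 := (Real.continuous_sqrt.tendsto _).comp h1
  rwa [Real.sqrt_sq (norm_nonneg _)] at h2

/-- Diagonal sequences: countably many conditions on a contraction of the ultraproduct can be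
satisfied simultaneously if finitely many of them always can be. -/
theorem exists_diagonal_sequence (hω : (ω : Filter ℕ) ≤ cofinite) (F : ℕ → ∀ n, M n → ℝ)
    (y : ℕ → BddSeq M) (hy1 : ∀ k, ‖y k‖ ≤ 1)
    (hy : ∀ k, ∀ j < k, ∀ δ > 0, ∀ᶠ n in ω, F j n (y k n) < δ) :
    ∃ x : BddSeq M, ‖x‖ ≤ 1 ∧ ∀ j, ∀ δ > 0, ∀ᶠ n in ω, F j n (x n) < δ := by
  classical
  -- The diagonal uses at `n` the largest good `k`. The clause `k ≤ n` keeps it within the search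
  -- bound and holds eventually along `ω` because `ω` is free; the tolerance `1 / (k + 1)` then
  -- tends to zero.
  set good : ℕ → ℕ → Prop := fun n k => k ≤ n ∧ ∀ j < k, F j n (y k n) < 1 / (k + 1) with hgood
  have hev : ∀ k, ∀ᶠ n in ω, good n k := by
    intro k
    have h1 : ∀ᶠ n in ω, k ≤ n :=
      hω (Nat.cofinite_eq_atTop ▸ eventually_ge_atTop k)
    have h2 : ∀ᶠ n in ω, ∀ j ∈ Set.Iio k, F j n (y k n) < 1 / (k + 1) :=
      (eventually_all_finite (Set.finite_Iio k)).mpr fun j hj => hy k j hj _ (by positivity)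
    exact h1.and h2
  set κ : ℕ → ℕ := fun n => Nat.findGreatest (good n) n
  have hx1 : ∀ n, ‖y (κ n) n‖ ≤ 1 := fun n => ((y (κ n)).norm_apply_le n).trans (hy1 _)
  have hmem : Memℓp (fun n => y (κ n) n) ∞ :=
    memℓp_infty ⟨1, by rintro _ ⟨n, rfl⟩; exact hx1 n⟩
  refine ⟨(⟨fun n => y (κ n) n, hmem⟩ : lp M ∞), lp.norm_le_of_forall_le zero_le_one hx1, ?_⟩
  intro j δ hδ
  obtain ⟨k, hk⟩ := exists_nat_one_div_lt hδ
  filter_upwards [hev (max (j + 1) k)] with n hn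
  have h1 : max (j + 1) k ≤ κ n := Nat.le_findGreatest hn.1 hn
  have h2 : good n (κ n) := Nat.findGreatest_spec hn.1 hn
  refine (h2.2 j (by omega)).trans (lt_of_le_of_lt ?_ hk)
  have h3 : (k : ℝ) ≤ κ n := by exact_mod_cast (le_max_right _ _).trans h1
  gcongr

/-- For saturation, approximate solutions lift to sequences of contractions. Each condition is an
`ω`-limit of termwise conditions, so a diagonal sequence satisfies all of them in the limit. -/
theorem isSaturatedTracial_ultraproduct (hω : (ω : Filter ℕ) ≤ cofinite) :
    IsSaturatedTracial (ultraproduct τ ω) (traceVec τ ω) where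
  norm_star := by
    rintro _ ⟨x, rfl⟩
    have h1 := norm_traceVec_sq τ ω x
    have h2 := norm_traceVec_sq τ ω (star x)
    rw [star_star, limTrace_mul_comm, ← h1, map_star] at h2
    exact (pow_left_inj₀ (norm_nonneg _) (norm_nonneg _) two_ne_zero).mp (by exact_mod_cast h2)
  dense := by
    refine (UniformSpace.Completion.denseRange_coe (α := (limTrace τ ω).PreGNS)).mono ?_
    rintro _ ⟨v, rfl⟩
    refine ⟨ultraClass τ ω ((limTrace τ ω).ofPreGNS v), ⟨_, rfl⟩, ?_⟩
    simp only [traceVec, ultraClass_coe, mul_one, PositiveLinearMap.toPreGNS_ofPreGNS]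
  posPart_mem := by
    rintro _ ⟨x, rfl⟩ hs
    exact (ultraClass τ ω).exists_apply_eq_posPart x hs
  saturated := by
    intro a b c G ha hb hc hG h
    choose a' ha' using ha
    choose b' hb' using hb
    choose c' hc' using hc
    have hlift : ∀ k, ∃ y : BddSeq M, ‖y‖ ≤ 1 ∧ ∀ j < k,
        G j ‖ultraClass τ ω (y * a' j + b' j * y + c' j) (traceVec τ ω)‖ ≤ 0 := by
      intro k
      obtain ⟨_, ⟨x, rfl⟩, hx1, hxG⟩ := h k
      obtain ⟨y, hy1, hyx⟩ := exists_norm_le_one_lift (ultraClass τ ω) x hx1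
      refine ⟨y, hy1, fun j hj => ?_⟩
      have := hxG j hj
      rw [← ha' j, ← hb' j, ← hc' j] at this
      rw [map_add, map_add, map_mul, map_mul, hyx]
      exact this
    choose y hy1 hyG using hlift
    set F : ℕ → ∀ n, M n → ℝ := fun j n z =>
      G j √(τ n (star (z * a' j n + b' j n * z + c' j n) *
        (z * a' j n + b' j n * z + c' j n))).re with hF
    have hlim : ∀ (x : BddSeq M) (j : ℕ), Tendsto (fun n => F j n (x n)) ω
        (𝓝 (G j ‖ultraClass τ ω (x * a' j + b' j * x + c' j) (traceVec τ ω)‖)) := fun x j =>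
      ((hG j).tendsto _).comp (tendsto_sqrt_trace τ ω (x * a' j + b' j * x + c' j))
    obtain ⟨x, hx1, hx⟩ := exists_diagonal_sequence ω hω F y hy1 fun k j hj δ hδ =>
      (hlim (y k) j).eventually_lt_const ((hyG k j hj).trans_lt hδ)
    refine ⟨ultraClass τ ω x, ⟨x, rfl⟩, ?_, fun j => ?_⟩
    · exact (NonUnitalStarAlgHom.norm_apply_le (ultraClass τ ω) x).trans hx1
    · have h1 : G j ‖ultraClass τ ω (x * a' j + b' j * x + c' j) (traceVec τ ω)‖ ≤ 0 :=
        le_of_forall_pos_le_add fun δ hδ => by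
          rw [zero_add]
          exact le_of_tendsto (hlim x j) ((hx j δ hδ).mono fun n hn => hn.le)
      rw [map_add, map_add, map_mul, map_mul] at h1
      rw [← ha' j, ← hb' j, ← hc' j]
      exact h1

end UltraproductSaturated

theorem theorem1p7 {M : ℕ → Type*} [∀ n, CStarAlgebra (M n)] [∀ n, WStarAlgebra (M n)]
    [∀ n, Nontrivial (M n)] (hM : ∀ n, IsFiniteFactor (M n))
    (hdim : ∀ k : ℕ, ∀ᶠ n in atTop, (k : Cardinal) ≤ Module.rank ℂ (M n))
    (τ : ∀ n, TracialState (M n)) (ω : Ultrafilter ℕ) (hω : (ω : Filter ℕ) ≤ cofinite)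
    (P : VonNeumannAlgebra (UltraL2 τ ω)) (hPM : ∀ x ∈ P, x ∈ ultraproduct τ ω)
    (hP : IsSeparableTwo (traceVec τ ω) (P : Set (UltraL2 τ ω →L[ℂ] UltraL2 τ ω))) :
    ∃ (z₀ z₁ : UltraL2 τ ω →L[ℂ] UltraL2 τ ω)
      (h₀ : IsCentralProjection (relCommutant P (ultraproduct τ ω)) z₀)
      (h₁ : IsCentralProjection (relCommutant P (ultraproduct τ ω)) z₁),
      z₀ * z₁ = 0 ∧ z₀ + z₁ = 1 ∧
      IsAtomicAlgebra (directSummand _ h₀) ∧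
      IsDiffuseAlgebra (directSummand _ h₁) ∧
      HasNoSeparableSummand (traceVec τ ω) (directSummand _ h₁) ∧
      ∀ A, IsMASA A (directSummand _ h₁) → HasNoSeparableSummand (traceVec τ ω) A := by
  have hsat := isSaturatedTracial_ultraproduct τ ω hω
  obtain ⟨q, h₀, h₁, hatom, hdiff⟩ := isCornerCommutant_relCommutant.exists_atomic_part hsat
    (mem_relCommutant_iff.mpr ⟨one_mem (ultraproduct τ ω), fun y _ => by rw [mul_one, one_mul]⟩ :
      (1 : UltraL2 τ ω →L[ℂ] UltraL2 τ ω) ∈ relCommutant P (ultraproduct τ ω))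
  exact ⟨q, 1 - q, h₀, h₁, h₀.proj.mul_one_sub_self, add_sub_cancel _ _, hatom, hdiff,
    hasNoSeparableSummand_of_isDiffuse hsat hPM hP h₁ hdiff,
    fun _ hA => hA.hasNoSeparableSummand hsat hPM hP h₁ hdiff⟩
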